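/- Let $d\ge 1$ and let $\Omega\subseteq[0,1]^d$ be Lebesgue measurable with $\mu_d(\partial\Omega)=0$ and $\mu_d(\Omega)>0$, where $\mu_k$ denotes Lebesgue measure on $\mathbb R^k$. Let $p:[0,1]^d\to\mathbb R$ be a function whose restriction $p|_\Omega$ is continuous at almost every point of $\Omega$. Fix $m\ge 0$ and pairwise distinct nonzero multi-indices $\mathbf t_1,\dots,\mathbf t_m\in\mathbb N_0^d$, listed in increasing lexicographic order. For each $k$ let $[\mathbf t_k]$ be the set of all vectors $\boldsymbol\alpha=(\pm(t_k)_1,\dots,\pm(t_k)_d)$ whose first nonzero component is positive, and fix real weights $(w_{k,\boldsymbol\alpha})_{\boldsymbol\alpha\in[\mathbf t_k]}$, not all zero. All these data are independent of $\mathbf n$. For $\mathbf n\in\mathbb N^d$ and $\mathbf 1\le \mathbf i,\mathbf j\le\mathbf n$ (componentwise) put $\mathbf x_{\mathbf j}=\big(\tfrac{j_1}{n_1+1},\dots,\tfrac{j_d}{n_d+1}\big)$ and let $w(\mathbf i,\mathbf j)=w_{k,\boldsymbol\alpha}$ if $\mathbf i-\mathbf j=\pm\boldsymbol\alpha$ for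 some $k$ and some $\boldsymbol\alpha\in[\mathbf t_k]$ (which are then unique), and $w(\mathbf i,\mathbf j)=0$ otherwise. The $d$-level Toeplitz grid graph in $\Omega$ has the nodes $\mathbf j$ with $\mathbf 1\le\mathbf j\le\mathbf n$ and $\mathbf x_{\mathbf j}\in\Omega$; let $d_{\mathbf n}$ be their number, and let $$W_{\mathbf n}^{\Omega,p}=\Big(p\big(\tfrac{\mathbf x_{\mathbf i}+\mathbf x_{\mathbf j}}2\big)\,w(\mathbf i,\mathbf j)\Big)_{\mathbf i,\mathbf j:\ \mathbf x_{\mathbf i},\mathbf x_{\mathbf j}\in\Omega}\in\mathbb R^{d_{\mathbf n}\times d_{\mathbf n}}$$ be its adjacency matrix. Set $$f(\boldsymbol\theta)=\sum_{k=1}^m\sum_{\boldsymbol\alpha\in[\mathbf t_k]}2\,w_{k,\boldsymbol\alpha}\cos(\boldsymbol\alpha\cdot\boldsymbol\theta),\qquad g(\mathbf x,\boldsymbol\theta)=p(\mathbf x)f(\boldsymbol\theta),\qquad D=\Omega\times[-\pi,\pi]^d .$$ Then $\{W_{\mathbf n}^{\Omega,p}\}_{\mathbf n}\sim_\lambda g$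 on $D$. That is, $0<\mu_{2d}(D)<\infty$, $g$ is Lebesgue measurable on $D$, $d_{\mathbf n}\to\infty$ as $\mathbf n\to\infty$ (i.e. as $\min_r n_r\to\infty$), and for every continuous compactly supported $F:\mathbb C\to\mathbb C$ $$\lim_{\mathbf n\to\infty}\frac1{d_{\mathbf n}}\sum_{k=1}^{d_{\mathbf n}}F\big(\lambda_k(W_{\mathbf n}^{\Omega,p})\big)=\frac1{\mu_{2d}(D)}\int_{D}F\big(p(\mathbf x)f(\boldsymbol\theta)\big)\,d\mathbf x\,d\boldsymbol\theta ,$$ where $\lambda_1(W_{\mathbf n}^{\Omega,p}),\dots,\lambda_{d_{\mathbf n}}(W_{\mathbf n}^{\Omega,p})$ are the eigenvalues of $W_{\mathbf n}^{\Omega,p}$, counted with multiplicity. -/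

import Mathlib

open MeasureTheory Filter Topology

namespace ToeplitzGrid

/-! ### Weighted graphs and adjacency matrices -/

/-- An undirected weighted graph without loops on the node set `V` (no potential term): a symmetric
weight function vanishing on the diagonal.  Its edges are the pairs of nonzero weight. -/
structure WeightedGraph (V : Type*) where
  weight : V → V → ℝ
  symm : ∀ u v, weight u v = weight v u
  loopless : ∀ v, weight v v = 0

namespace WeightedGraph

/-- The edge set: all pairs of nonzero weight. -/
def edges {V : Type*} (G : WeightedGraph V) : Set (V × V) := {e | G.weight e.1 e.2 ≠ 0}

/-- The adjacency matrix. -/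
def adjacencyMatrix {V : Type*} (G : WeightedGraph V) : Matrix V V ℝ :=
  Matrix.of G.weight

/-- The sub-graph on the nodes `U`, embedded in `V` by `f`, with the weights restricted. -/
def restrict {U V : Type*} (G : WeightedGraph V) (f : U ↪ V) : WeightedGraph U where
  weight u v := G.weight (f u) (f v)
  symm _ _ := G.symm _ _
  loopless _ := G.loopless _

end WeightedGraph

/-! ### Directions and `d`-level Toeplitz graphs -/

/-- The directions of `t ∈ ℕ^d`, `t ≠ 0`, are the classes `{u, -u}` of vectors
`u = (± t₁, …, ± t_d)`.  Each class is represented by its member whose first nonzero component is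
positive, and this is the set of these representatives. -/
noncomputable def directions {d : ℕ} (t : Fin d → ℕ) : Finset (Fin d → ℤ) :=
  (Finset.Icc (fun r => -(t r : ℤ)) (fun r => (t r : ℤ))).filter fun u =>
    (∀ r, |u r| = (t r : ℤ)) ∧ ∃ r, 0 < u r ∧ ∀ s, s < r → u s = 0

/-- The data `{[t₁], w₁}, …, {[t_m], w_m}` of a `d`-level Toeplitz graph, none of it depending on
the size `n`: nonzero multi-indices `t₁ ◁ … ◁ t_m` with nonnegative components, increasing in the
lexicographic order, and for each of them a nonzero vector of weights, one weight for each
direction. -/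
structure ToeplitzData (d : ℕ) where
  m : ℕ
  t : Fin m → Fin d → ℕ
  t_ne_zero : ∀ k, t k ≠ 0
  t_strictMono : StrictMono fun k => toLex (t k)
  w : (k : Fin m) → directions (t k) → ℝ
  w_ne_zero : ∀ k, w k ≠ 0

namespace ToeplitzData

variable {d : ℕ}

/-- The weight attached to a difference `u = i - j` of multi-indices: it is `w_k α` if `u = α` or
`u = -α` for a direction `α` of `t_k`, and `0` if there is no such direction.  At most one term of
the sum is nonzero, see `coeff_eq` and `coeff_eq_zero`. -/
noncomputable def coeff (T : ToeplitzData d) (u : Fin d → ℤ) : ℝ :=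
  ∑ k : Fin T.m, ∑ α : directions (T.t k), if u = α.1 ∨ u = -α.1 then T.w k α else 0

/-- The trigonometric polynomial
`f(θ) = ∑_k ∑_{α ∈ [t_k]} 2 w_{k,α} cos(α · θ)`. -/
noncomputable def symbol (T : ToeplitzData d) (θ : Fin d → ℝ) : ℝ :=
  ∑ k : Fin T.m, ∑ α : directions (T.t k), 2 * T.w k α * Real.cos (∑ r, (α.1 r : ℝ) * θ r)

theorem abs_of_mem {t : Fin d → ℕ} {u α : Fin d → ℤ} (hα : α ∈ directions t)
    (h : u = α ∨ u = -α) (r : Fin d) : |u r| = (t r : ℤ) := by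
  have := (Finset.mem_filter.1 hα).2.1 r
  rcases h with rfl | rfl <;> simpa using this

theorem direction_unique {t : Fin d → ℕ} {u α β : Fin d → ℤ} (hα : α ∈ directions t)
    (hβ : β ∈ directions t) (hu : u = α ∨ u = -α) (hv : u = β ∨ u = -β) : α = β := by
  have key : ∀ γ : Fin d → ℤ, γ ∈ directions t → -γ ∈ directions t → False := by
    intro γ h₁ h₂
    obtain ⟨r, hr, hr'⟩ := (Finset.mem_filter.1 h₁).2.2
    obtain ⟨s, hs, hs'⟩ := (Finset.mem_filter.1 h₂).2.2
    simp only [Pi.neg_apply] at hs hs'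
    rcases lt_trichotomy r s with h | h | h
    · have := hs' r h; omega
    · subst h; omega
    · have := hr' s h; omega
  rcases hu with rfl | rfl <;> rcases hv with h | h
  · exact h
  · exact (key β hβ (h ▸ hα)).elim
  · exact (key α hα (h ▸ hβ)).elim
  · exact neg_injective h

theorem coeff_eq (T : ToeplitzData d) (k : Fin T.m) (α : directions (T.t k)) (u : Fin d → ℤ)
    (h : u = α.1 ∨ u = -α.1) : T.coeff u = T.w k α := by
  unfold coeff
  rw [Finset.sum_eq_single k, Finset.sum_eq_single α]
  · simp [h]
  · intro β _ hβ
    rw [if_neg]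
    exact fun h' => hβ (Subtype.ext (direction_unique β.2 α.2 h' h))
  · simp
  · intro l _ hl
    refine Finset.sum_eq_zero fun β _ => if_neg fun h' => hl (T.t_strictMono.injective ?_)
    refine congrArg toLex (funext fun r => ?_)
    exact_mod_cast (abs_of_mem β.2 h' r).symm.trans (abs_of_mem α.2 h r)
  · simp

theorem coeff_eq_zero (T : ToeplitzData d) (u : Fin d → ℤ)
    (h : ∀ k, ∃ r, |u r| ≠ (T.t k r : ℤ)) : T.coeff u = 0 := by
  refine Finset.sum_eq_zero fun k _ => Finset.sum_eq_zero fun α _ => if_neg fun h' => ?_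
  obtain ⟨r, hr⟩ := h k
  exact hr (abs_of_mem α.2 h' r)

theorem coeff_neg (T : ToeplitzData d) (u : Fin d → ℤ) : T.coeff (-u) = T.coeff u := by
  refine Finset.sum_congr rfl fun k _ => Finset.sum_congr rfl fun α _ => ?_
  simp only [neg_eq_iff_eq_neg, neg_neg, or_comm]

theorem coeff_zero (T : ToeplitzData d) : T.coeff 0 = 0 := by
  refine T.coeff_eq_zero 0 fun k => ?_
  obtain ⟨r, hr⟩ := Function.ne_iff.1 (T.t_ne_zero k)
  exact ⟨r, fun h => hr (by simpa using h.symm)⟩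

/-- The node indices `j` with `1 ≤ j ≤ n` componentwise. -/
def box (n : Fin d → ℕ) : Finset (Fin d → ℕ) := Finset.Icc 1 n

/-- The `d`-level Toeplitz graph of size `n`.  (The usual restriction that the `t_k` be small with
respect to `n` holds for all large `n`; for the other `n` the formula still makes sense.) -/
noncomputable def toeplitzGraph (T : ToeplitzData d) (n : Fin d → ℕ) : WeightedGraph (box n) where
  weight i j := T.coeff fun r => (i.1 r : ℤ) - (j.1 r : ℤ)
  symm i j := by
    rw [← T.coeff_neg]
    congr 1
    funext r
    simp
  loopless i := by
    simp only [sub_self]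
    exact T.coeff_zero

/-! ### Grid graphs in the cube and in a domain -/

/-- The grid point `x_j = (j₁ / (n₁ + 1), …, j_d / (n_d + 1))`. -/
noncomputable def gridPoint (n j : Fin d → ℕ) : Fin d → ℝ :=
  fun r => (j r : ℝ) / ((n r : ℝ) + 1)

/-- The `d`-level Toeplitz grid graph in the cube: the weights of the Toeplitz graph are multiplied
by the value of `p` at the midpoint of the two grid points.  Only the values of `p` on the unit
cube matter. -/
noncomputable def cubeGridGraph (T : ToeplitzData d) (p : (Fin d → ℝ) → ℝ) (n : Fin d → ℕ) :
    WeightedGraph (box n) where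
  weight i j :=
    p ((1 / 2 : ℝ) • (gridPoint n i.1 + gridPoint n j.1)) * (T.toeplitzGraph n).weight i j
  symm i j := by rw [add_comm, (T.toeplitzGraph n).symm]
  loopless i := by rw [(T.toeplitzGraph n).loopless, mul_zero]

open scoped Classical in
/-- The nodes whose grid points lie in `Ω`. -/
noncomputable def domainNodes (Ω : Set (Fin d → ℝ)) (n : Fin d → ℕ) : Finset (Fin d → ℕ) :=
  (box n).filter fun j => gridPoint n j ∈ Ω

theorem domainNodes_subset (Ω : Set (Fin d → ℝ)) (n : Fin d → ℕ) :
    domainNodes Ω n ⊆ box n := by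
  classical exact Finset.filter_subset _ _

/-- The `d`-level Toeplitz grid graph immersed in `Ω`: the sub-graph of the grid graph in the cube
on the nodes lying in `Ω`. -/
noncomputable def domainGridGraph (T : ToeplitzData d) (p : (Fin d → ℝ) → ℝ)
    (Ω : Set (Fin d → ℝ)) (n : Fin d → ℕ) : WeightedGraph (domainNodes Ω n) :=
  (T.cubeGridGraph p n).restrict
    ⟨fun j => ⟨j.1, domainNodes_subset Ω n j.2⟩, fun _ _ h =>
      Subtype.ext (congrArg (fun x : box n => x.1) h)⟩

end ToeplitzData

/-- A regular subset of the unit cube: Lebesgue measurable, with a boundary of Lebesgue measure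
zero. -/
structure IsRegularDomain {d : ℕ} (Ω : Set (Fin d → ℝ)) : Prop where
  subset_cube : Ω ⊆ Set.Icc 0 1
  measurable : NullMeasurableSet Ω volume
  frontier_null : volume (frontier Ω) = 0

/-! ### Asymptotic eigenvalue distribution -/

/-- `Σ_λ(F, A)`: the mean of `F` over the eigenvalues of `A`, counted with multiplicity. -/
noncomputable def eigenvalueMean {V : Type*} [Fintype V] [DecidableEq V] (F : ℂ → ℂ)
    (A : Matrix V V ℂ) : ℂ :=
  (Fintype.card V : ℂ)⁻¹ * (A.charpoly.roots.map F).sum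

/-- `{X_n} ∼_λ g` on `D`, for matrices `X_n` of dimensions tending to infinity, indexed by
multi-indices `n`, and a measurable real function `g` on a measurable set `D` of finite positive
measure.  The filter `atTop` on `Fin d → ℕ` is the convergence `min_r n_r → ∞`. -/
structure HasSpectralSymbol {d : ℕ} {V : (Fin d → ℕ) → Type*} [∀ n, Fintype (V n)]
    [∀ n, DecidableEq (V n)] (X : (n : Fin d → ℕ) → Matrix (V n) (V n) ℂ)
    {E : Type*} [MeasureSpace E] (D : Set E) (g : E → ℝ) : Prop where
  card_tendsto : Tendsto (fun n => Fintype.card (V n)) atTop atTop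
  measurable_domain : NullMeasurableSet D volume
  volume_pos : 0 < volume D
  volume_lt_top : volume D < ⊤
  measurable_symbol : AEMeasurable g (volume.restrict D)
  tendsto_mean : ∀ F : ℂ → ℂ, Continuous F → HasCompactSupport F →
    Tendsto (fun n => eigenvalueMean F (X n)) atTop
      (𝓝 (((volume D).toReal : ℂ)⁻¹ * ∫ y in D, F (g y : ℂ)))

end ToeplitzGrid

/-! The proof compares resolvents. For non-real `z`, the mean of `1 / (λ - z)` over the eigenvalues
is the normalised trace of `(W - z)⁻¹`, so it suffices to find the diagonal entries of the resolvent
asymptotically.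

Near a node close to an interior point `x` at which `p` is continuous, `W` looks like the Laurent
operator with symbol `p(x) f`, because the weights have finite range. The inverse of `p(x) f - z` on
the whole lattice has diagonal entry equal to the mean of `1 / (p(x) f - z)` over the torus. A
trigonometric polynomial uniformly close to `1 / (p(x) f - z)` yields a finitely supported
approximate solution of `(p(x) f - z) u = δ₀` (`exists_approx_solution`). Placed around the node, it
still solves the equation for `W` up to a small error. The bound `|Im z| ‖v‖ ≤ ‖(W - z) v‖` for
Hermitian `W` then puts the diagonal entry close to `u 0` (`tendsto_nodeDiag_resolvent`).

Diagonal entries are at most `1 / |Im z|` in norm and the boundary of `Ω` is null, so dominated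
convergence turns the trace into an integral over `Ω` (`tendsto_sum_domainNodes`). Finally, by
Stone–Weierstrass, the constants and the functions `1 / (x - z)` span a dense subspace of the
continuous functions on the one-point compactification of the line, and both sides are contractive
functionals there (`tendsto_of_tendsto_resolventMap`). No bound on `p` or on the norm of `W` enters.
-/

namespace ToeplitzGrid

/-! ### Approximate inverses of Toeplitz symbols on the torus -/

section Torus

open UnitAddTorus

/- The measure on the circle used in the theory of multiple Fourier series has total mass one. -/
attribute [local instance] instMeasureSpaceUnitAddCircle

local instance : IsProbabilityMeasure (volume : Measure UnitAddCircle) :=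
  inferInstanceAs (IsProbabilityMeasure AddCircle.haarAddCircle)

/-- The `s`-th Fourier coefficient of a continuous function on the torus, as a continuous linear
functional. -/
noncomputable def torusCoeff {d : ℕ} (s : Fin d → ℤ) : C(UnitAddTorus (Fin d), ℂ) →L[ℂ] ℂ :=
  (innerSL ℂ (mFourierLp (d := Fin d) 2 s)).comp (ContinuousMap.toLp 2 volume ℂ)

theorem torusCoeff_apply {d : ℕ} (s : Fin d → ℤ) (G : C(UnitAddTorus (Fin d), ℂ)) :
    torusCoeff s G = inner ℂ (mFourierLp (d := Fin d) 2 s) (ContinuousMap.toLp 2 volume ℂ G) := rfl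

theorem torusCoeff_mFourier {d : ℕ} (s k : Fin d → ℤ) :
    torusCoeff s (mFourier k) = if s = k then 1 else 0 :=
  orthonormal_iff_ite.mp (orthonormal_mFourier (d := Fin d)) s k

theorem torusCoeff_zero {d : ℕ} (G : C(UnitAddTorus (Fin d), ℂ)) :
    torusCoeff 0 G = ∫ y, G y := by
  rw [torusCoeff_apply, ContinuousMap.inner_toLp]
  simp [mFourier_zero]

theorem norm_toLp_le_norm {d : ℕ} (G : C(UnitAddTorus (Fin d), ℂ)) :
    ‖ContinuousMap.toLp (E := ℂ) 2 (volume : Measure (UnitAddTorus (Fin d))) ℂ G‖ ≤ ‖G‖ := by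
  have h := (ContinuousMap.toLp (E := ℂ) 2 (volume : Measure (UnitAddTorus (Fin d))) ℂ).le_of_opNorm_le
    (ContinuousMap.toLp_norm_le (E := ℂ) (𝕜 := ℂ) (p := 2)
      (μ := (volume : Measure (UnitAddTorus (Fin d))))) G
  simpa [measureUnivNNReal, measure_univ] using h

/-- Bessel's inequality on a probability space: it converts a uniform error on the torus into an ℓ²
error on the lattice. -/
theorem sum_norm_torusCoeff_sq_le {d : ℕ} (S : Finset (Fin d → ℤ))
    (G : C(UnitAddTorus (Fin d), ℂ)) : ∑ s ∈ S, ‖torusCoeff s G‖ ^ 2 ≤ ‖G‖ ^ 2 :=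
  ((orthonormal_mFourier (d := Fin d)).sum_inner_products_le _).trans
    (pow_le_pow_left₀ (norm_nonneg _) (norm_toLp_le_norm G) 2)

namespace ToeplitzData

variable {d : ℕ}

/-- The symbol of a Toeplitz graph as a function on the torus. -/
noncomputable def torusSymbol (T : ToeplitzData d) : C(UnitAddTorus (Fin d), ℂ) :=
  ∑ k : Fin T.m, ∑ α : directions (T.t k),
    (T.w k α : ℂ) • (mFourier α.1 + mFourier (-α.1))

theorem mFourier_coe_div (α : Fin d → ℤ) (θ : Fin d → ℝ) :
    mFourier α (fun r => ((θ r / (2 * Real.pi) : ℝ) : UnitAddCircle)) =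
      Complex.exp ((∑ r, (α r : ℝ) * θ r : ℝ) * Complex.I) := by
  simp only [mFourier, ContinuousMap.coe_mk, fourier_coe_apply, ← Complex.exp_sum]
  congr 1
  push_cast
  rw [Finset.sum_mul]
  refine Finset.sum_congr rfl fun r _ => ?_
  have : (Real.pi : ℂ) ≠ 0 := by exact_mod_cast Real.pi_ne_zero
  field_simp

theorem torusSymbol_coe_div (T : ToeplitzData d) (θ : Fin d → ℝ) :
    T.torusSymbol (fun r => ((θ r / (2 * Real.pi) : ℝ) : UnitAddCircle)) = (T.symbol θ : ℂ) := by
  simp only [torusSymbol, symbol, ContinuousMap.coe_sum, Finset.sum_apply, ContinuousMap.coe_smul,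
    Pi.smul_apply, ContinuousMap.add_apply, Complex.ofReal_sum, mFourier_coe_div, smul_eq_mul]
  refine Finset.sum_congr rfl fun k _ => Finset.sum_congr rfl fun α _ => ?_
  rw [Complex.ofReal_mul, Complex.ofReal_mul, Complex.ofReal_cos, Complex.cos]
  simp only [Pi.neg_apply, Int.cast_neg, neg_mul, Finset.sum_neg_distrib, Complex.ofReal_neg,
    Complex.ofReal_ofNat]
  rw [mul_assoc (2 : ℂ), mul_comm (2 : ℂ), mul_assoc, div_mul_cancel₀ _ two_ne_zero]
  push_cast
  rfl

/-- Every point of the torus lifts to real angles. Real values keep `c * f - z` away from zero for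
non-real `z`. -/
theorem exists_torusSymbol_eq (T : ToeplitzData d) (y : UnitAddTorus (Fin d)) :
    ∃ a : ℝ, T.torusSymbol y = a := by
  choose x hx using fun r => QuotientAddGroup.mk_surjective (y r)
  refine ⟨T.symbol fun r => 2 * Real.pi * x r, ?_⟩
  rw [← torusSymbol_coe_div]
  congr 1
  funext r
  rw [mul_div_cancel_left₀ _ (by positivity)]
  exact (hx r).symm

/-- In the Fourier basis, multiplication by the symbol is the infinite Toeplitz matrix of the
weights. -/
theorem torusCoeff_torusSymbol_mul (T : ToeplitzData d) (s k : Fin d → ℤ) :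
    torusCoeff s (T.torusSymbol * mFourier k) = (T.coeff (s - k) : ℂ) := by
  have key : ∀ m : Fin d → ℤ, (mFourier m : C(UnitAddTorus (Fin d), ℂ)) * mFourier k =
      mFourier (m + k) := fun m => by
    ext y
    simp [mFourier_add]
  simp only [torusSymbol, coeff, Finset.sum_mul, smul_mul_assoc, add_mul, key, map_sum, map_smul,
    map_add, torusCoeff_mFourier, Complex.ofReal_sum]
  refine Finset.sum_congr rfl fun l _ => Finset.sum_congr rfl fun α _ => ?_
  -- The two exponentials of a direction sit at different frequencies, so their indicators add up to
  -- the indicator of the disjunction in `coeff`.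
  have hne : α.1 ≠ -α.1 := by
    obtain ⟨r, hr, -⟩ := (Finset.mem_filter.1 α.2).2.2
    intro h
    have := congrFun h r
    simp only [Pi.neg_apply] at this
    omega
  simp only [← sub_eq_iff_eq_add]
  by_cases h1 : s - k = α.1
  · have h2 : ¬ s - k = -α.1 := h1 ▸ hne
    simp [h1, hne]
  · by_cases h2 : s - k = -α.1 <;> simp [h1, h2, hne.symm]

theorem mul_torusSymbol_sub_ne_zero (T : ToeplitzData d) (c : ℝ) {z : ℂ} (hz : z.im ≠ 0)
    (y : UnitAddTorus (Fin d)) : (c : ℂ) * T.torusSymbol y - z ≠ 0 := by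
  obtain ⟨a, ha⟩ := T.exists_torusSymbol_eq y
  intro h
  apply hz
  rw [ha, sub_eq_zero, ← Complex.ofReal_mul] at h
  rw [← h, Complex.ofReal_im]

-- Substitution `x = θ / 2π` on the fundamental domain `(-1/2, 1/2]^d`; passing to the closed cube
-- changes only a null set.
open scoped Pointwise in
theorem integral_torus_eq {E : Type*} [NormedAddCommGroup E] [NormedSpace ℝ E]
    (G : UnitAddTorus (Fin d) → E) :
    ∫ y, G y = ((2 * Real.pi) ^ d)⁻¹ •
      ∫ θ in Set.Icc (fun _ : Fin d => -Real.pi) (fun _ => Real.pi),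
        G fun r => ((θ r / (2 * Real.pi) : ℝ) : UnitAddCircle) := by
  have hpi : 0 < 2 * Real.pi := by positivity
  have h1 := Measure.setIntegral_comp_smul (volume : Measure (Fin d → ℝ))
    (fun x => G fun r => ((x r : ℝ) : UnitAddCircle))
    (Set.univ.pi fun _ : Fin d => Set.Ioc (-Real.pi) Real.pi) (inv_ne_zero hpi.ne')
  have h2 : (2 * Real.pi)⁻¹ • (Set.univ.pi fun _ : Fin d => Set.Ioc (-Real.pi) Real.pi) =
      {x : Fin d → ℝ | ∀ i, x i ∈ Set.Ioc ((fun _ => -(1 / 2) : Fin d → ℝ) i)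
        ((fun _ => -(1 / 2) : Fin d → ℝ) i + 1)} := by
    ext x
    rw [Set.mem_inv_smul_set_iff₀ hpi.ne']
    simp only [Set.mem_univ_pi, Pi.smul_apply, smul_eq_mul, Set.mem_Ioc, Set.mem_ofPred_eq]
    refine forall_congr' fun i => and_congr ?_ ?_
    · constructor <;> intro h <;> nlinarith [Real.pi_pos]
    · constructor <;> intro h <;> nlinarith [Real.pi_pos]
  rw [h2, ← integral_preimage] at h1
  have h3 : (Set.univ.pi fun _ : Fin d => Set.Ioc (-Real.pi) Real.pi) =ᵐ[volume]
      Set.Icc (fun _ : Fin d => -Real.pi) (fun _ => Real.pi) :=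
    Measure.univ_pi_Ioc_ae_eq_Icc
  rw [setIntegral_congr_set h3] at h1
  simp only [Pi.smul_apply, smul_eq_mul, ← div_eq_inv_mul] at h1
  rw [h1, smul_smul]
  simp only [Module.finrank_fin_fun, inv_pow, inv_inv]
  rw [abs_of_pos (by positivity), inv_mul_cancel₀ (by positivity), one_smul]

/-- The mean of `1 / (c * f - z)` over the angles, where `f` is the symbol. -/
noncomputable def localResolvent (T : ToeplitzData d) (z : ℂ) (c : ℝ) : ℂ :=
  ((2 * Real.pi) ^ d)⁻¹ • ∫ θ in Set.Icc (fun _ : Fin d => -Real.pi) (fun _ => Real.pi),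
    (((c * T.symbol θ : ℝ) : ℂ) - z)⁻¹

theorem localResolvent_eq (T : ToeplitzData d) (z : ℂ) (c : ℝ) :
    T.localResolvent z c = ∫ y, ((c : ℂ) * T.torusSymbol y - z)⁻¹ := by
  rw [integral_torus_eq]
  simp only [localResolvent, torusSymbol_coe_div, Complex.ofReal_mul]

/-- The infinite Toeplitz operator with symbol `c * f - z` has a finitely supported approximate
fundamental solution, whose value at the origin is close to the mean of `1 / (c * f - z)`. -/
theorem exists_approx_solution (T : ToeplitzData d) (c : ℝ) {z : ℂ} (hz : z.im ≠ 0) {ε : ℝ}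
    (hε : 0 < ε) :
    ∃ u : (Fin d → ℤ) →₀ ℂ, ‖u 0 - T.localResolvent z c‖ ≤ ε ∧
      ∀ S : Finset (Fin d → ℤ),
        ∑ s ∈ S, ‖∑ k ∈ u.support, (c : ℂ) * T.coeff (s - k) * u k - z * u s -
          (if s = 0 then 1 else 0)‖ ^ 2 ≤ ε ^ 2 := by
  have hne := T.mul_torusSymbol_sub_ne_zero c hz
  let P : C(UnitAddTorus (Fin d), ℂ) := (c : ℂ) • T.torusSymbol - z • 1
  let H : C(UnitAddTorus (Fin d), ℂ) :=
    ⟨fun y => ((c : ℂ) * T.torusSymbol y - z)⁻¹, by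
      exact Continuous.inv₀ (by fun_prop) hne⟩
  have hPH : P * H = 1 := by
    ext y
    simp [P, H, hne y]
  -- With this `δ`, both `‖q - H‖` and `‖P * q - 1‖ = ‖P * (q - H)‖` are at most `ε`.
  set δ : ℝ := ε / (‖P‖ + 1) with hδ
  have hδ0 : 0 < δ := by positivity
  have hδε : δ ≤ ε := div_le_self hε.le (by linarith [norm_nonneg P])
  have hPδ : ‖P‖ * δ ≤ ε := by
    rw [hδ, mul_div_assoc', div_le_iff₀ (by positivity)]
    nlinarith [norm_nonneg P]
  have hmem : H ∈ (Submodule.span ℂ (Set.range (mFourier (d := Fin d)))).topologicalClosure := by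
    rw [span_mFourier_closure_eq_top]
    trivial
  obtain ⟨q, hq, hqH⟩ := Metric.mem_closure_iff.1 hmem δ hδ0
  obtain ⟨u, rfl⟩ := (Finsupp.mem_span_range_iff_exists_finsupp).1 hq
  set q : C(UnitAddTorus (Fin d), ℂ) := u.sum fun i a => a • mFourier i with hqdef
  have hdist : ‖q - H‖ ≤ δ := by
    rw [← dist_eq_norm, dist_comm]
    exact hqH.le
  have hcoeff : ∀ s, torusCoeff s q = u s := by
    intro s
    simp only [hqdef, Finsupp.sum, map_sum, map_smul, torusCoeff_mFourier, smul_eq_mul]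
    simp +contextual
  refine ⟨u, ?_, fun S => ?_⟩
  · rw [localResolvent_eq]
    have h1 : u 0 - ∫ y, ((c : ℂ) * T.torusSymbol y - z)⁻¹ = torusCoeff 0 (q - H) := by
      rw [map_sub, hcoeff, torusCoeff_zero]
      rfl
    have h2 := sum_norm_torusCoeff_sq_le {0} (q - H)
    rw [Finset.sum_singleton] at h2
    rw [h1]
    exact (le_of_sq_le_sq h2 (norm_nonneg _)).trans (hdist.trans hδε)
  -- The residuals are exactly the Fourier coefficients of `P * q - 1`, so Bessel's inequality
  -- bounds them.
  · have h1 : ‖P * q - 1‖ ≤ ε := by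
      rw [← hPH, ← mul_sub]
      exact (norm_mul_le _ _).trans
        ((mul_le_mul_of_nonneg_left hdist (norm_nonneg _)).trans hPδ)
    refine le_trans (le_of_eq ?_) ((sum_norm_torusCoeff_sq_le S (P * q - 1)).trans
      (pow_le_pow_left₀ (norm_nonneg _) h1 2))
    refine Finset.sum_congr rfl fun s _ => ?_
    congr 2
    have h3 : torusCoeff s (1 : C(UnitAddTorus (Fin d), ℂ)) = if s = 0 then 1 else 0 := by
      rw [← mFourier_zero, torusCoeff_mFourier]
    rw [map_sub, h3]
    congr 1
    simp only [P, sub_mul, map_sub, smul_mul_assoc, one_mul, map_smul, hcoeff, smul_eq_mul]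
    congr 1
    simp only [hqdef, Finsupp.sum, Finset.mul_sum, mul_smul_comm, map_sum, map_smul,
      torusCoeff_torusSymbol_mul, smul_eq_mul]
    exact Finset.sum_congr rfl fun k _ => by ring

end ToeplitzData

end Torus

/-! ### Resolvents of Hermitian matrices -/

section Resolvent

open Matrix

variable {V : Type*} [Fintype V] [DecidableEq V]

theorem eigenvalueMean_eq_sum {A : Matrix V V ℂ} (hA : A.IsHermitian) (F : ℂ → ℂ) :
    eigenvalueMean F A = (Fintype.card V : ℂ)⁻¹ * ∑ i, F (hA.eigenvalues i : ℂ) := by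
  rw [eigenvalueMean, hA.roots_charpoly_eq_eigenvalues, Multiset.map_map]
  rfl

theorem ofReal_sub_ne_zero (a : ℝ) {z : ℂ} (hz : z.im ≠ 0) : (a : ℂ) - z ≠ 0 := by
  intro h
  apply hz
  rw [← sub_eq_zero.1 h, Complex.ofReal_im]

theorem exists_resolvent {A : Matrix V V ℂ} (hA : A.IsHermitian) {z : ℂ} (hz : z.im ≠ 0) :
    ∃ G : Matrix V V ℂ, (A - z • 1) * G = 1 ∧
      G.trace = ∑ i, ((hA.eigenvalues i : ℂ) - z)⁻¹ := by
  set U : Matrix V V ℂ := hA.eigenvectorUnitary.1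
  have h1 : star U * U = 1 := Unitary.coe_star_mul_self hA.eigenvectorUnitary
  have h2 : U * star U = 1 := Unitary.coe_mul_star_self hA.eigenvectorUnitary
  have hAU : A = U * diagonal (fun i => (hA.eigenvalues i : ℂ)) * star U := by
    conv_lhs => rw [hA.spectral_theorem, Unitary.conjStarAlgAut_apply]
    rfl
  have hz1 : z • (1 : Matrix V V ℂ) = U * diagonal (fun _ => z) * star U := by
    rw [← smul_one_eq_diagonal, mul_smul_comm, smul_mul_assoc, mul_one, h2]
  refine ⟨U * diagonal (fun i => ((hA.eigenvalues i : ℂ) - z)⁻¹) * star U, ?_, ?_⟩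
  · have h3 : A - z • 1 = U * diagonal (fun i => (hA.eigenvalues i : ℂ) - z) * star U := by
      rw [hz1]
      conv_lhs => rw [hAU]
      rw [← sub_mul, ← mul_sub, diagonal_sub]
    rw [h3]
    calc _ = U * diagonal (fun i => (hA.eigenvalues i : ℂ) - z) * (star U * U) *
          diagonal (fun i => ((hA.eigenvalues i : ℂ) - z)⁻¹) * star U := by
            simp only [mul_assoc]
      _ = 1 := by
        rw [h1, mul_one, mul_assoc U, diagonal_mul_diagonal]
        simp [ofReal_sub_ne_zero _ hz, h2]
  · rw [trace_mul_comm, ← mul_assoc, h1, one_mul, trace_diagonal]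

/-- The lower bound `|Im z| ‖v‖ ≤ ‖(A - z) v‖` for Hermitian `A`. -/
theorem sq_mul_sum_norm_sq_le {A : Matrix V V ℂ} (hA : A.IsHermitian) (z : ℂ) (v : V → ℂ) :
    z.im ^ 2 * ∑ i, ‖v i‖ ^ 2 ≤ ∑ i, ‖((A - z • 1) *ᵥ v) i‖ ^ 2 := by
  set r := (A - z • 1) *ᵥ v with hr
  have hn : ∀ w : V → ℂ, star w ⬝ᵥ w = ((∑ i, ‖w i‖ ^ 2 : ℝ) : ℂ) := fun w => by
    simp [dotProduct, Complex.conj_mul', Complex.ofReal_sum]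
  have him : (star v ⬝ᵥ (A *ᵥ v)).im = 0 := hA.im_star_dotProduct_mulVec_self v
  -- The quadratic form of `A` is real, so only `z` contributes to the imaginary part.
  -- Cauchy–Schwarz then gives the bound after division by `∑ ‖v i‖ ^ 2`.
  have h1 : (star v ⬝ᵥ r).im = -z.im * ∑ i, ‖v i‖ ^ 2 := by
    rw [hr, sub_mulVec, dotProduct_sub, Complex.sub_im, him, smul_mulVec, one_mulVec,
      dotProduct_smul, hn, smul_eq_mul, Complex.im_mul_ofReal]
    ring
  have h2 : ‖star v ⬝ᵥ r‖ ^ 2 ≤ (∑ i, ‖v i‖ ^ 2) * ∑ i, ‖r i‖ ^ 2 := by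
    have : ‖star v ⬝ᵥ r‖ ≤ ∑ i, ‖v i‖ * ‖r i‖ :=
      (norm_sum_le _ _).trans (le_of_eq (by simp))
    exact (pow_le_pow_left₀ (norm_nonneg _) this 2).trans
      (Finset.sum_mul_sq_le_sq_mul_sq _ _ _)
  have h3 : (z.im * ∑ i, ‖v i‖ ^ 2) ^ 2 ≤ (∑ i, ‖v i‖ ^ 2) * ∑ i, ‖r i‖ ^ 2 := by
    refine le_trans ?_ h2
    rw [← sq_abs]
    refine pow_le_pow_left₀ (abs_nonneg _) ?_ 2
    have := Complex.abs_im_le_norm (star v ⬝ᵥ r)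
    rwa [h1, neg_mul, abs_neg] at this
  rcases (Finset.sum_nonneg fun i _ => sq_nonneg ‖v i‖ :
    0 ≤ ∑ i, ‖v i‖ ^ 2).eq_or_lt with h | h
  · rw [← h, mul_zero]
    exact Finset.sum_nonneg fun i _ => sq_nonneg _
  · refine le_of_mul_le_mul_left ?_ h
    linarith

/-- An approximate solution `v` of `(A - z) v = e_j` approximates the diagonal entry of the
resolvent. -/
theorem abs_im_mul_norm_sub_resolvent_le {A G : Matrix V V ℂ} (hA : A.IsHermitian) (z : ℂ)
    (hG : (A - z • 1) * G = 1) (j : V) (v : V → ℂ) {ε : ℝ} (hε : 0 ≤ ε)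
    (hv : ∑ i, ‖((A - z • 1) *ᵥ v) i - Pi.single (M := fun _ => ℂ) j 1 i‖ ^ 2 ≤ ε ^ 2) :
    |z.im| * ‖v j - G j j‖ ≤ ε := by
  have h0 : (A - z • 1) *ᵥ (G *ᵥ Pi.single j 1) = Pi.single j 1 := by
    rw [mulVec_mulVec, hG, one_mulVec]
  have h1 := sq_mul_sum_norm_sq_le hA z (v - G *ᵥ Pi.single j 1)
  rw [mulVec_sub, h0] at h1
  have h2 : ‖v j - G j j‖ ^ 2 ≤ ∑ i, ‖(v - G *ᵥ Pi.single j 1) i‖ ^ 2 := by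
    have := Finset.single_le_sum (f := fun i => ‖(v - G *ᵥ Pi.single j 1) i‖ ^ 2)
      (fun i _ => sq_nonneg _) (Finset.mem_univ j)
    simpa [mulVec_single_one] using this
  have h3 : (|z.im| * ‖v j - G j j‖) ^ 2 ≤ ε ^ 2 := by
    rw [mul_pow, sq_abs]
    exact (mul_le_mul_of_nonneg_left h2 (sq_nonneg _)).trans (h1.trans hv)
  exact le_of_sq_le_sq h3 hε

theorem abs_im_mul_norm_resolvent_le {A G : Matrix V V ℂ} (hA : A.IsHermitian) (z : ℂ)
    (hG : (A - z • 1) * G = 1) (j : V) : |z.im| * ‖G j j‖ ≤ 1 := by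
  -- The zero vector is an approximate solution with error exactly `1`.
  have := abs_im_mul_norm_sub_resolvent_le hA z hG j 0 zero_le_one (by
    rw [Finset.sum_eq_single j] <;> simp +contextual)
  simpa using this

end Resolvent
/-! ### Riemann sums over grid points -/

namespace ToeplitzData

variable {d : ℕ}

/-- The index of the grid cell containing a point. -/
noncomputable def cellIndex (n : Fin d → ℕ) (x : Fin d → ℝ) : Fin d → ℕ :=
  fun r => ⌊x r * ((n r : ℝ) + 1)⌋₊

/-- The inverse of the volume of a grid cell. -/
noncomputable def cellCount (n : Fin d → ℕ) : ℝ := ∏ r, ((n r : ℝ) + 1)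

theorem cellCount_pos (n : Fin d → ℕ) : 0 < cellCount n :=
  Finset.prod_pos fun r _ => by positivity

/-- The condition `1 ≤ j` matters: the natural floor sends all negative numbers to `0`, so cells
with a zero index are unbounded. -/
theorem cellIndex_eq_iff {n j : Fin d → ℕ} (hj : 1 ≤ j) {x : Fin d → ℝ} :
    cellIndex n x = j ↔ x ∈ Set.univ.pi fun r =>
      Set.Ico ((j r : ℝ) / ((n r : ℝ) + 1)) (((j r : ℝ) + 1) / ((n r : ℝ) + 1)) := by
  rw [funext_iff, Set.mem_univ_pi]
  refine forall_congr' fun r => ?_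
  have hjr : j r ≠ 0 := Nat.one_le_iff_ne_zero.1 (hj r)
  have hn : (0 : ℝ) < (n r : ℝ) + 1 := by positivity
  rw [cellIndex, Nat.floor_eq_iff' hjr, Set.mem_Ico, div_le_iff₀ hn, lt_div_iff₀ hn]

theorem measurableSet_cell {n j : Fin d → ℕ} (hj : 1 ≤ j) :
    MeasurableSet {x | cellIndex n x = j} := by
  simp only [cellIndex_eq_iff hj, Set.ofPred_mem_eq]
  exact MeasurableSet.univ_pi fun r => measurableSet_Ico

theorem volume_cell {n j : Fin d → ℕ} (hj : 1 ≤ j) :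
    volume.real {x | cellIndex n x = j} = (cellCount n)⁻¹ := by
  simp only [cellIndex_eq_iff hj, Set.ofPred_mem_eq]
  rw [measureReal_def, volume_pi, Measure.pi_pi, ENNReal.toReal_prod, cellCount,
    ← Finset.prod_inv_distrib]
  refine Finset.prod_congr rfl fun r _ => ?_
  rw [Real.volume_Ico, ENNReal.toReal_ofReal] <;>
    rw [← sub_div, add_sub_cancel_left]
  · rw [one_div]
  · positivity

theorem tendsto_apply_atTop (r : Fin d) :
    Tendsto (fun n : Fin d → ℕ => n r) atTop atTop :=
  tendsto_atTop_atTop.2 fun b => ⟨fun _ => b, fun _ h => h r⟩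

theorem tendsto_apply_add_one_atTop (r : Fin d) :
    Tendsto (fun n : Fin d → ℕ => (n r : ℝ) + 1) atTop atTop :=
  tendsto_atTop_add_const_right _ _
    (tendsto_natCast_atTop_atTop.comp (tendsto_apply_atTop r))

theorem tendsto_cellCount (hd : 1 ≤ d) :
    Tendsto (cellCount : (Fin d → ℕ) → ℝ) atTop atTop := by
  let r₀ : Fin d := ⟨0, hd⟩
  refine tendsto_atTop_mono (fun n => ?_) (tendsto_apply_add_one_atTop r₀)
  rw [cellCount, ← Finset.mul_prod_erase _ _ (Finset.mem_univ r₀)]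
  refine le_mul_of_one_le_right (by positivity) ?_
  exact Finset.one_le_prod fun r _ => by simp

theorem tendsto_cellIndex_div {x : Fin d → ℝ} (hx : 0 ≤ x) (r : Fin d) :
    Tendsto (fun n : Fin d → ℕ => (cellIndex n x r : ℝ) / ((n r : ℝ) + 1)) atTop (𝓝 (x r)) :=
  (tendsto_nat_floor_mul_div_atTop (hx r)).comp (tendsto_apply_add_one_atTop r)

theorem tendsto_gridPoint_cellIndex {x : Fin d → ℝ} (hx : 0 ≤ x) :
    Tendsto (fun n : Fin d → ℕ => gridPoint n (cellIndex n x)) atTop (𝓝 x) :=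
  tendsto_pi_nhds.2 fun r => tendsto_cellIndex_div hx r

theorem mem_domainNodes {Ω : Set (Fin d → ℝ)} {n j : Fin d → ℕ} :
    j ∈ domainNodes Ω n ↔ (1 ≤ j ∧ j ≤ n) ∧ gridPoint n j ∈ Ω := by
  classical
  simp [domainNodes, box]

theorem mem_Ioo_of_mem_interior {Ω : Set (Fin d → ℝ)} (hΩ : IsRegularDomain Ω) {x : Fin d → ℝ}
    (hx : x ∈ interior Ω) (r : Fin d) : x r ∈ Set.Ioo (0 : ℝ) 1 := by
  have h1 := interior_mono hΩ.subset_cube hx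
  rw [← Set.pi_univ_Icc, interior_pi_set Set.finite_univ] at h1
  simpa [interior_Icc] using h1 r (Set.mem_univ r)

/-- The interior of `Ω` lies in the open cube, which forces `0 < y r < n r + 1`. Integer indices
allow shifts of a node by arbitrary offsets. -/
theorem exists_mem_domainNodes {Ω : Set (Fin d → ℝ)} (hΩ : IsRegularDomain Ω) {n : Fin d → ℕ}
    {y : Fin d → ℤ} (hy : (fun r => (y r : ℝ) / ((n r : ℝ) + 1)) ∈ interior Ω) :
    ∃ j ∈ domainNodes Ω n, ∀ r, (j r : ℤ) = y r := by
  have hpos : ∀ r, 0 < y r ∧ y r < n r + 1 := fun r => by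
    have h1 := mem_Ioo_of_mem_interior hΩ hy r
    have h2 : (0 : ℝ) < (n r : ℝ) + 1 := by positivity
    rw [Set.mem_Ioo, div_lt_one h2, div_pos_iff_of_pos_right h2] at h1
    exact_mod_cast h1
  have hj : ∀ r, ((y r).toNat : ℤ) = y r := fun r => Int.toNat_of_nonneg (hpos r).1.le
  refine ⟨fun r => (y r).toNat, mem_domainNodes.2 ⟨⟨fun r => ?_, fun r => ?_⟩, ?_⟩, hj⟩
  · have := hpos r
    simp only [Pi.one_apply]
    omega
  · have := hpos r
    dsimp only
    omega
  · convert interior_subset hy using 2 with r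
    simp only [gridPoint]
    congr 1
    exact_mod_cast hj r

theorem mem_domainNodes_of_mem_interior {Ω : Set (Fin d → ℝ)} (hΩ : IsRegularDomain Ω)
    {n j : Fin d → ℕ} (hj : gridPoint n j ∈ interior Ω) : j ∈ domainNodes Ω n := by
  obtain ⟨l, hl, h⟩ := exists_mem_domainNodes hΩ (n := n) (y := fun r => (j r : ℤ))
    (by simp only [Int.cast_natCast]; exact hj)
  convert hl using 1
  funext r
  exact_mod_cast (h r).symm

theorem nonneg_of_one_le_cellIndex {n : Fin d → ℕ} {x : Fin d → ℝ} (h : 1 ≤ cellIndex n x) :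
    0 ≤ x := fun r => by
  have h1 : 1 ≤ ⌊x r * ((n r : ℝ) + 1)⌋₊ := h r
  have h2 := (Nat.one_le_floor_iff _).1 h1
  have h3 : (0 : ℝ) < (n r : ℝ) + 1 := by positivity
  exact (pos_of_mul_pos_left (zero_lt_one.trans_le h2) h3.le).le

open scoped Classical in
/-- The step function on the grid cells attached to a function on the nodes. -/
noncomputable def cellStep (Ω : Set (Fin d → ℝ)) (n : Fin d → ℕ) (c : (Fin d → ℕ) → ℂ)
    (x : Fin d → ℝ) : ℂ :=
  if cellIndex n x ∈ domainNodes Ω n then c (cellIndex n x) else 0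

theorem cellStep_eq_sum (Ω : Set (Fin d → ℝ)) (n : Fin d → ℕ) (c : (Fin d → ℕ) → ℂ) :
    cellStep Ω n c = fun x =>
      ∑ j ∈ domainNodes Ω n, {x | cellIndex n x = j}.indicator (fun _ => c j) x := by
  classical
  funext x
  simp only [cellStep, Set.indicator_apply, Set.mem_ofPred_eq]
  rw [Finset.sum_ite_eq]

theorem integral_cellStep (Ω : Set (Fin d → ℝ)) (n : Fin d → ℕ) (c : (Fin d → ℕ) → ℂ) :
    ∫ x, cellStep Ω n c x = (cellCount n : ℂ)⁻¹ * ∑ j ∈ domainNodes Ω n, c j := by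
  have hone : ∀ j ∈ domainNodes Ω n, 1 ≤ j := fun j hj => (mem_domainNodes.1 hj).1.1
  have hreal : ∀ j ∈ domainNodes Ω n,
      volume.real {x | cellIndex n x = j} = (cellCount n)⁻¹ := fun j hj => volume_cell (hone j hj)
  rw [cellStep_eq_sum, integral_finsetSum, Finset.mul_sum]
  · refine Finset.sum_congr rfl fun j hj => ?_
    rw [integral_indicator_const _ (measurableSet_cell (hone j hj)), hreal j hj,
      Complex.real_smul, Complex.ofReal_inv]
  · intro j hj
    refine (integrable_indicator_iff (measurableSet_cell (hone j hj))).2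
      (integrableOn_const ?_)
    intro h
    have := hreal j hj
    rw [measureReal_def, h] at this
    exact (inv_pos.2 (cellCount_pos n)).ne this

/-- Sums over the nodes in a regular domain converge to integrals, under pointwise convergence
along the cells containing almost every point. -/
theorem tendsto_sum_domainNodes {Ω : Set (Fin d → ℝ)} (hΩ : IsRegularDomain Ω)
    (c : (Fin d → ℕ) → (Fin d → ℕ) → ℂ) (C : ℝ) (hC : ∀ n, ∀ j ∈ domainNodes Ω n, ‖c n j‖ ≤ C)
    (h : (Fin d → ℝ) → ℂ)
    (hc : ∀ᵐ x, x ∈ interior Ω → Tendsto (fun n => c n (cellIndex n x)) atTop (𝓝 (h x))) :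
    Tendsto (fun n => (cellCount n : ℂ)⁻¹ * ∑ j ∈ domainNodes Ω n, c n j) atTop
      (𝓝 (∫ x in Ω, h x)) := by
  simp only [← integral_cellStep]
  rw [← integral_indicator₀ hΩ.measurable]
  refine tendsto_integral_filter_of_dominated_convergence
    ((Set.Icc (0 : Fin d → ℝ) 1).indicator fun _ => |C|) ?_ ?_ ?_ ?_
  · refine Eventually.of_forall fun n => ?_
    rw [cellStep_eq_sum]
    refine (Finset.measurable_sum _ fun j hj => ?_).aestronglyMeasurable
    exact measurable_const.indicator (measurableSet_cell (mem_domainNodes.1 hj).1.1)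
  · refine Eventually.of_forall fun n => Eventually.of_forall fun x => ?_
    unfold cellStep
    split_ifs with hx
    · have hx' := (mem_domainNodes.1 hx).1
      rw [Set.indicator_of_mem]
      · exact (hC n _ hx).trans (le_abs_self C)
      -- The cell reaches up to `(j + 1) / (n + 1)`, which is at most `1` since `j ≤ n`; hence it
      -- stays inside the cube.
      · refine ⟨nonneg_of_one_le_cellIndex hx'.1, fun r => ?_⟩
        have h1 := ((cellIndex_eq_iff hx'.1).1 rfl) r (Set.mem_univ r)
        have h2 : (cellIndex n x r : ℝ) ≤ n r := by exact_mod_cast hx'.2 r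
        refine h1.2.le.trans ?_
        rw [div_le_iff₀ (by positivity)]
        simpa using h2
    · rw [norm_zero]
      exact Set.indicator_nonneg (fun _ _ => abs_nonneg C) _
  · exact (integrable_indicator_iff measurableSet_Icc).2
      (integrableOn_const isCompact_Icc.measure_ne_top)
  · have hfr : ∀ᵐ x : Fin d → ℝ, x ∉ frontier Ω := measure_eq_zero_iff_ae_notMem.1 hΩ.frontier_null
    filter_upwards [hc, hfr] with x hx hxf
    by_cases hint : x ∈ interior Ω
    · have hxΩ : x ∈ Ω := interior_subset hint
      have hx0 : 0 ≤ x := fun r => (mem_Ioo_of_mem_interior hΩ hint r).1.le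
      rw [Set.indicator_of_mem hxΩ]
      refine (hx hint).congr' ?_
      have h1 : ∀ᶠ n : Fin d → ℕ in atTop, gridPoint n (cellIndex n x) ∈ interior Ω :=
        (tendsto_gridPoint_cellIndex hx0).eventually (isOpen_interior.mem_nhds hint)
      filter_upwards [h1] with n hn
      rw [cellStep, if_pos (mem_domainNodes_of_mem_interior hΩ hn)]
    · have hxc : x ∉ closure Ω := fun h => hxf ⟨h, hint⟩
      rw [Set.indicator_of_notMem fun h => hxc (subset_closure h)]
      refine tendsto_const_nhds.congr' ?_
      -- Grid points of the cells approach `x` only if `x` has no negative coordinate; otherwise the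
      -- cell of `x` is never that of a node.
      by_cases hx0 : 0 ≤ x
      · filter_upwards [(tendsto_gridPoint_cellIndex hx0).eventually
          (isClosed_closure.isOpen_compl.mem_nhds hxc)] with n hn
        rw [cellStep, if_neg fun h => hn (subset_closure (mem_domainNodes.1 h).2)]
      · refine Eventually.of_forall fun n => (if_neg fun h => ?_).symm
        exact hx0 (nonneg_of_one_le_cellIndex (mem_domainNodes.1 h).1.1)

end ToeplitzData
/-! ### Local asymptotics of the resolvent -/

namespace ToeplitzData

open Matrix

variable {d : ℕ}

/-- The difference of two multi-indices. -/
def indexDiff (j l : Fin d → ℕ) : Fin d → ℤ := fun r => (l r : ℤ) - (j r : ℤ)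

theorem indexDiff_injective (j : Fin d → ℕ) : Function.Injective (indexDiff j) := by
  intro l l' h
  funext r
  have := congrFun h r
  simp only [indexDiff] at this
  omega

theorem indexDiff_sub_indexDiff (j i l : Fin d → ℕ) :
    indexDiff j i - indexDiff j l = fun r => (i r : ℤ) - (l r : ℤ) := by
  funext r
  simp [indexDiff]

theorem indexDiff_eq_zero_iff {j l : Fin d → ℕ} : indexDiff j l = 0 ↔ l = j := by
  rw [← (indexDiff_injective j).eq_iff (a := l) (b := j)]
  simp [indexDiff, funext_iff]

theorem sum_indexDiff_eq {V : Finset (Fin d → ℕ)} {K : Finset (Fin d → ℤ)} (j : Fin d → ℕ)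
    (hK : ∀ k ∈ K, ∃ l ∈ V, indexDiff j l = k) (φ : (Fin d → ℤ) → ℂ) (hφ : ∀ k ∉ K, φ k = 0) :
    ∑ l : V, φ (indexDiff j l.1) = ∑ k ∈ K, φ k := by
  classical
  rw [Finset.sum_coe_sort V fun l => φ (indexDiff j l),
    ← Finset.sum_image (f := φ) (indexDiff_injective j).injOn]
  exact (Finset.sum_subset (fun k hk => Finset.mem_image.2 (hK k hk)) fun k _ => hφ k).symm

/-- Offsets in `S` need not be realised by nodes; nonnegativity makes the inequality survive, and it
suffices for error terms. -/
theorem sum_indexDiff_le {V : Finset (Fin d → ℕ)} {S : Finset (Fin d → ℤ)} (j : Fin d → ℕ)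
    (φ : (Fin d → ℤ) → ℝ) (h0 : ∀ s, 0 ≤ φ s) (hφ : ∀ s ∉ S, φ s = 0) :
    ∑ l : V, φ (indexDiff j l.1) ≤ ∑ s ∈ S, φ s := by
  classical
  rw [Finset.sum_coe_sort V fun l => φ (indexDiff j l),
    ← Finset.sum_image (f := φ) (indexDiff_injective j).injOn,
    ← Finset.sum_filter_of_ne (p := (· ∈ S)) fun s _ hs => by_contra fun h => hs (hφ s h)]
  exact Finset.sum_le_sum_of_subset_of_nonneg (fun s hs => (Finset.mem_filter.1 hs).2)
    fun s _ _ => h0 s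

theorem exists_finset_coeff_eq_zero (T : ToeplitzData d) :
    ∃ K : Finset (Fin d → ℤ), ∀ u ∉ K, T.coeff u = 0 := by
  classical
  refine ⟨Finset.univ.biUnion fun k => Finset.Icc (fun r => -(T.t k r : ℤ)) fun r => T.t k r,
    fun u hu => T.coeff_eq_zero u fun k => ?_⟩
  by_contra! h
  refine hu (Finset.mem_biUnion.2 ⟨k, Finset.mem_univ k, Finset.mem_Icc.2
    ⟨fun r => ?_, fun r => ?_⟩⟩)
  · exact (abs_le.1 (h r).le).1
  · exact (abs_le.1 (h r).le).2

/-- The grid point with an integral index, relative to the cell of `x`. -/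
noncomputable def nearPoint (x : Fin d → ℝ) (n : Fin d → ℕ) (k : Fin d → ℤ) : Fin d → ℝ :=
  fun r => ((cellIndex n x r + k r : ℤ) : ℝ) / ((n r : ℝ) + 1)

theorem tendsto_nearPoint {x : Fin d → ℝ} (hx : 0 ≤ x) (k : Fin d → ℤ) :
    Tendsto (fun n => nearPoint x n k) atTop (𝓝 x) := by
  refine tendsto_pi_nhds.2 fun r => ?_
  have h1 := (tendsto_cellIndex_div hx r).add
    ((tendsto_apply_add_one_atTop r).const_div_atTop (k r : ℝ))
  rw [add_zero] at h1
  refine h1.congr fun n => ?_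
  simp only [nearPoint]
  push_cast
  rw [add_div]

theorem gridPoint_eq_nearPoint (x : Fin d → ℝ) (n l : Fin d → ℕ) :
    gridPoint n l = nearPoint x n (indexDiff (cellIndex n x) l) := by
  funext r
  simp [gridPoint, nearPoint, indexDiff]

/-- The complex adjacency matrix of the grid graph in a domain. -/
noncomputable abbrev gridMatrix (T : ToeplitzData d) (p : (Fin d → ℝ) → ℝ)
    (Ω : Set (Fin d → ℝ)) (n : Fin d → ℕ) : Matrix (domainNodes Ω n) (domainNodes Ω n) ℂ :=
  (T.domainGridGraph p Ω n).adjacencyMatrix.map fun a : ℝ => (a : ℂ)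

theorem gridMatrix_isHermitian (T : ToeplitzData d) (p : (Fin d → ℝ) → ℝ)
    (Ω : Set (Fin d → ℝ)) (n : Fin d → ℕ) : (T.gridMatrix p Ω n).IsHermitian := by
  ext i j
  simp only [gridMatrix, conjTranspose_apply, map_apply, WeightedGraph.adjacencyMatrix, of_apply]
  rw [(T.domainGridGraph p Ω n).symm]
  exact Complex.conj_ofReal _

theorem gridMatrix_apply (T : ToeplitzData d) (p : (Fin d → ℝ) → ℝ) (Ω : Set (Fin d → ℝ))
    (n : Fin d → ℕ) (x : Fin d → ℝ) (i l : domainNodes Ω n) :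
    T.gridMatrix p Ω n i l =
      (p ((1 / 2 : ℝ) • (nearPoint x n (indexDiff (cellIndex n x) i) +
        nearPoint x n (indexDiff (cellIndex n x) l))) : ℂ) *
      T.coeff (indexDiff (cellIndex n x) i - indexDiff (cellIndex n x) l) := by
  rw [indexDiff_sub_indexDiff, ← gridPoint_eq_nearPoint, ← gridPoint_eq_nearPoint,
    ← Complex.ofReal_mul]
  rfl

/-- The residual, at the offset `s` from the cell of `x`, of the vector with finitely supported
profile `u` around that cell. -/
noncomputable def residual (T : ToeplitzData d) (p : (Fin d → ℝ) → ℝ) (z : ℂ)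
    (u : (Fin d → ℤ) →₀ ℂ) (x : Fin d → ℝ) (n : Fin d → ℕ) (s : Fin d → ℤ) : ℂ :=
  ∑ k ∈ u.support, (p ((1 / 2 : ℝ) • (nearPoint x n s + nearPoint x n k)) : ℂ) *
    T.coeff (s - k) * u k - z * u s - (if s = 0 then 1 else 0)

/-- At fixed offsets all midpoints tend to `x`, so continuity freezes the coefficient at `p x`. The
limit is the residual controlled by `exists_approx_solution`. -/
theorem tendsto_residual (T : ToeplitzData d) {p : (Fin d → ℝ) → ℝ} (z : ℂ)
    (u : (Fin d → ℤ) →₀ ℂ) {x : Fin d → ℝ} (hx : 0 ≤ x) (hp : ContinuousAt p x)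
    (s : Fin d → ℤ) :
    Tendsto (fun n => T.residual p z u x n s) atTop
      (𝓝 (∑ k ∈ u.support, (p x : ℂ) * T.coeff (s - k) * u k - z * u s -
        (if s = 0 then 1 else 0))) := by
  refine ((tendsto_finsetSum _ fun k _ => ?_).sub_const _).sub_const _
  refine (Tendsto.mul_const _ ?_).mul_const _
  refine (Complex.continuous_ofReal.tendsto _).comp (Tendsto.comp hp ?_)
  have h := ((tendsto_nearPoint hx s).add (tendsto_nearPoint hx k)).const_smul (1 / 2 : ℝ)
  have hxx : (1 / 2 : ℝ) • (x + x) = x := by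
    rw [← two_smul ℝ x, smul_smul]
    norm_num
  rwa [hxx] at h

/-- As the whole support of `u` is realised by nodes, restricting to `Ω` drops no term of the
product. -/
theorem gridMatrix_mulVec_sub_single (T : ToeplitzData d) (p : (Fin d → ℝ) → ℝ) (z : ℂ)
    (u : (Fin d → ℤ) →₀ ℂ) {Ω : Set (Fin d → ℝ)} {x : Fin d → ℝ} {n : Fin d → ℕ}
    (hx : cellIndex n x ∈ domainNodes Ω n)
    (hu : ∀ k ∈ u.support, ∃ l ∈ domainNodes Ω n, indexDiff (cellIndex n x) l = k)
    (i : domainNodes Ω n) :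
    ((T.gridMatrix p Ω n - z • 1) *ᵥ fun l => u (indexDiff (cellIndex n x) l.1)) i -
        Pi.single (M := fun _ => ℂ) ⟨cellIndex n x, hx⟩ 1 i =
      T.residual p z u x n (indexDiff (cellIndex n x) i.1) := by
  rw [sub_mulVec, smul_mulVec, one_mulVec, residual, Pi.sub_apply, Pi.smul_apply, smul_eq_mul]
  congr 1
  · congr 1
    simp only [mulVec, dotProduct, T.gridMatrix_apply p Ω n x]
    refine sum_indexDiff_eq (cellIndex n x) hu (fun k =>
      (p ((1 / 2 : ℝ) • (nearPoint x n (indexDiff (cellIndex n x) i.1) + nearPoint x n k)) : ℂ) *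
        T.coeff (indexDiff (cellIndex n x) i.1 - k) * u k) fun k hk => ?_
    rw [Finsupp.notMem_support_iff.1 hk, mul_zero]
  · simp only [Pi.single_apply, indexDiff_eq_zero_iff, Subtype.ext_iff]

/-- Weights and profile both have finite range. Since `S` does not depend on `n`, pointwise
convergence of residuals gives convergence of their ℓ² norm. -/
theorem exists_finset_residual_eq_zero (T : ToeplitzData d) (z : ℂ) (u : (Fin d → ℤ) →₀ ℂ) :
    ∃ S : Finset (Fin d → ℤ), ∀ (p : (Fin d → ℝ) → ℝ) (x : Fin d → ℝ) (n : Fin d → ℕ),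
      ∀ s ∉ S, T.residual p z u x n s = 0 := by
  classical
  obtain ⟨K, hK⟩ := T.exists_finset_coeff_eq_zero
  refine ⟨u.support ∪ {0} ∪ Finset.image₂ (· + ·) K u.support, fun p x n s hs => ?_⟩
  simp only [Finset.mem_union, Finset.mem_singleton, not_or, Finset.mem_image₂] at hs
  rw [residual, Finset.sum_eq_zero, Finsupp.notMem_support_iff.1 hs.1.1, if_neg hs.1.2]
  · simp
  · intro k hk
    rw [hK (s - k) fun h => hs.2 ⟨s - k, h, k, hk, sub_add_cancel s k⟩]
    simp

open scoped Classical in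
/-- The diagonal of a matrix on the nodes of a domain, extended by zero to all multi-indices. -/
noncomputable def nodeDiag {Ω : Set (Fin d → ℝ)} {n : Fin d → ℕ}
    (G : Matrix (domainNodes Ω n) (domainNodes Ω n) ℂ) (j : Fin d → ℕ) : ℂ :=
  if h : j ∈ domainNodes Ω n then G ⟨j, h⟩ ⟨j, h⟩ else 0

theorem nodeDiag_of_mem {Ω : Set (Fin d → ℝ)} {n : Fin d → ℕ}
    (G : Matrix (domainNodes Ω n) (domainNodes Ω n) ℂ) {j : Fin d → ℕ}
    (h : j ∈ domainNodes Ω n) : nodeDiag G j = G ⟨j, h⟩ ⟨j, h⟩ := dif_pos h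

theorem sum_nodeDiag {Ω : Set (Fin d → ℝ)} {n : Fin d → ℕ}
    (G : Matrix (domainNodes Ω n) (domainNodes Ω n) ℂ) :
    ∑ j ∈ domainNodes Ω n, nodeDiag G j = G.trace := by
  rw [← Finset.sum_coe_sort, trace]
  exact Finset.sum_congr rfl fun j _ => nodeDiag_of_mem G j.2

/-- The diagonal entries of the resolvent converge to the local mean of `1 / (p(x) f - z)`. -/
theorem tendsto_nodeDiag_resolvent (T : ToeplitzData d) {p : (Fin d → ℝ) → ℝ}
    {Ω : Set (Fin d → ℝ)} (hΩ : IsRegularDomain Ω) {z : ℂ} (hz : z.im ≠ 0)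
    (G : ∀ n : Fin d → ℕ, Matrix (domainNodes Ω n) (domainNodes Ω n) ℂ)
    (hG : ∀ n, (T.gridMatrix p Ω n - z • 1) * G n = 1)
    {x : Fin d → ℝ} (hx : x ∈ interior Ω) (hp : ContinuousAt p x) :
    Tendsto (fun n => nodeDiag (G n) (cellIndex n x)) atTop (𝓝 (T.localResolvent z (p x))) := by
  have hx0 : 0 ≤ x := fun r => (mem_Ioo_of_mem_interior hΩ hx r).1.le
  have hz' : 0 < |z.im| := abs_pos.2 hz
  refine Metric.tendsto_nhds.2 fun ε hε => ?_
  -- Chosen so that the final error `2 * δ / |z.im| + δ` equals `ε / 2`; the factor `2` leaves room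
  -- between the limiting residual `δ` and the one at finite `n`.
  set δ : ℝ := ε / (2 * (2 / |z.im| + 1)) with hδ
  have hδ0 : 0 < δ := by positivity
  obtain ⟨u, hu0, hu⟩ := T.exists_approx_solution (p x) hz hδ0
  obtain ⟨S, hS⟩ := T.exists_finset_residual_eq_zero z u
  have hsum : ∀ᶠ n in atTop, ∑ s ∈ S, ‖T.residual p z u x n s‖ ^ 2 < (2 * δ) ^ 2 := by
    have h1 := tendsto_finsetSum S fun s _ => ((T.tendsto_residual z u hx0 hp s).norm.pow 2)
    refine h1.eventually_lt_const ((hu S).trans_lt ?_)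
    nlinarith
  -- The offset `0` is included so that the cell of `x` itself belongs to a node, even if `u 0 = 0`.
  have hnodes : ∀ᶠ n in atTop, ∀ k ∈ insert 0 u.support,
      ∃ l ∈ domainNodes Ω n, indexDiff (cellIndex n x) l = k := by
    refine (Finset.eventually_all _).2 fun k _ => ?_
    filter_upwards [(tendsto_nearPoint hx0 k).eventually (isOpen_interior.mem_nhds hx)] with n hn
    obtain ⟨l, hl, h⟩ := exists_mem_domainNodes hΩ hn
    refine ⟨l, hl, funext fun r => ?_⟩
    simp only [indexDiff, h r]
    ring
  filter_upwards [hsum, hnodes] with n hn1 hn2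
  obtain ⟨l, hl, hl0⟩ := hn2 0 (Finset.mem_insert_self _ _)
  rw [indexDiff_eq_zero_iff] at hl0
  subst hl0
  have hmain := abs_im_mul_norm_sub_resolvent_le (T.gridMatrix_isHermitian p Ω n) z (hG n)
    ⟨cellIndex n x, hl⟩ (fun l => u (indexDiff (cellIndex n x) l.1)) (ε := 2 * δ) (by positivity)
    (by
      simp only [T.gridMatrix_mulVec_sub_single p z u hl
        fun k hk => hn2 k (Finset.mem_insert_of_mem hk)]
      exact (sum_indexDiff_le (cellIndex n x) (fun s => ‖T.residual p z u x n s‖ ^ 2)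
        (fun s => sq_nonneg _) fun s hs => by simp [hS p x n s hs]).trans hn1.le)
  rw [indexDiff_eq_zero_iff.2 rfl, ← nodeDiag_of_mem (G n) hl, ← le_div_iff₀' hz'] at hmain
  rw [dist_eq_norm]
  calc _ ≤ ‖u 0 - nodeDiag (G n) (cellIndex n x)‖ + ‖u 0 - T.localResolvent z (p x)‖ := by
        rw [← norm_neg (u 0 - nodeDiag _ _)]
        refine le_trans (le_of_eq ?_) (norm_add_le _ _)
        congr 1
        ring
    _ ≤ 2 * δ / |z.im| + δ := add_le_add hmain hu0
    _ = ε / 2 := by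
        rw [hδ]
        field_simp
    _ < ε := half_lt_self hε

end ToeplitzData
/-! ### Resolvent functions determine limits of spectral means -/

/-- The function `x ↦ 1 / (x - z)` on the one-point compactification of the real line. -/
noncomputable def resolventMap (z : ℂ) (hz : z.im ≠ 0) : C(OnePoint ℝ, ℂ) :=
  OnePoint.continuousMapMk
    ⟨fun x : ℝ => ((x : ℂ) - z)⁻¹,
      Continuous.inv₀ (by fun_prop) fun x => ofReal_sub_ne_zero x hz⟩ 0 (by
    rw [coclosedCompact_eq_cocompact]
    have h1 : Tendsto (fun x : ℝ => (x : ℂ) - z) (cocompact ℝ) (cocompact ℂ) :=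
      (Homeomorph.subRight z).isClosedEmbedding.tendsto_cocompact.comp
        Complex.isometry_ofReal.isClosedEmbedding.tendsto_cocompact
    rw [← Metric.cobounded_eq_cocompact (α := ℂ)] at h1
    exact tendsto_inv₀_cobounded.comp h1)

theorem resolventMap_coe (z : ℂ) (hz : z.im ≠ 0) (x : ℝ) :
    resolventMap z hz (x : OnePoint ℝ) = ((x : ℂ) - z)⁻¹ := rfl

theorem resolventMap_infty (z : ℂ) (hz : z.im ≠ 0) :
    resolventMap z hz OnePoint.infty = 0 := rfl

theorem norm_resolventMap_le (z : ℂ) (hz : z.im ≠ 0) : ‖resolventMap z hz‖ ≤ |z.im|⁻¹ := by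
  refine (ContinuousMap.norm_le _ (by positivity)).2 fun x => ?_
  induction x using OnePoint.rec with
  | infty => rw [resolventMap_infty, norm_zero]; positivity
  | coe x =>
    rw [resolventMap_coe, norm_inv]
    refine inv_anti₀ (abs_pos.2 hz) ?_
    simpa using Complex.abs_im_le_norm ((x : ℂ) - z)

/-- The resolvent identity: it makes a product of two distinct resolvent functions a linear
combination of them. -/
theorem resolventMap_sub (z w : ℂ) (hz : z.im ≠ 0) (hw : w.im ≠ 0) :
    resolventMap z hz - resolventMap w hw = (z - w) • (resolventMap z hz * resolventMap w hw) := by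
  ext x
  induction x using OnePoint.rec with
  | infty => simp [resolventMap_infty]
  | coe x =>
    have h1 := ofReal_sub_ne_zero x hz
    have h2 := ofReal_sub_ne_zero x hw
    simp only [ContinuousMap.sub_apply, ContinuousMap.smul_apply, ContinuousMap.mul_apply,
      resolventMap_coe, smul_eq_mul]
    field_simp
    ring

theorem star_resolventMap (z : ℂ) (hz : z.im ≠ 0) :
    star (resolventMap z hz) = resolventMap (star z) (by simpa using hz) := by
  ext x
  induction x using OnePoint.rec with
  | infty => simp [resolventMap_infty]
  | coe x => simp [resolventMap_coe]

/-- The closed span of the constants and the resolvent functions. -/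
noncomputable def resolventSpan : Submodule ℂ C(OnePoint ℝ, ℂ) :=
  (Submodule.span ℂ (insert 1 {f | ∃ z hz, f = resolventMap z hz})).topologicalClosure

theorem one_mem_resolventSpan : (1 : C(OnePoint ℝ, ℂ)) ∈ resolventSpan :=
  Submodule.le_topologicalClosure _ (Submodule.subset_span (Set.mem_insert _ _))

theorem resolventMap_mem_resolventSpan (z : ℂ) (hz : z.im ≠ 0) :
    resolventMap z hz ∈ resolventSpan :=
  Submodule.le_topologicalClosure _
    (Submodule.subset_span (Set.mem_insert_of_mem _ ⟨z, hz, rfl⟩))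

theorem isClosed_resolventSpan : IsClosed (resolventSpan : Set C(OnePoint ℝ, ℂ)) :=
  Submodule.isClosed_topologicalClosure _

theorem resolventMap_mul_mem_of_ne {z w : ℂ} (hz : z.im ≠ 0) (hw : w.im ≠ 0) (h : z ≠ w) :
    resolventMap z hz * resolventMap w hw ∈ resolventSpan := by
  have h1 : resolventMap z hz * resolventMap w hw =
      (z - w)⁻¹ • (resolventMap z hz - resolventMap w hw) := by
    rw [resolventMap_sub, smul_smul, inv_mul_cancel₀ (sub_ne_zero.2 h), one_smul]
  rw [h1]
  exact resolventSpan.smul_mem _ (resolventSpan.sub_mem (resolventMap_mem_resolventSpan z hz)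
    (resolventMap_mem_resolventSpan w hw))

theorem resolventMap_mul_mem (z w : ℂ) (hz : z.im ≠ 0) (hw : w.im ≠ 0) :
    resolventMap z hz * resolventMap w hw ∈ resolventSpan := by
  by_cases h : z = w
  swap
  · exact resolventMap_mul_mem_of_ne hz hw h
  subst h
  refine isClosed_resolventSpan.closure_subset_iff.2 subset_rfl (Metric.mem_closure_iff.2
    fun ε hε => ?_)
  set b : ℝ := |z.im|⁻¹ with hb
  have hb0 : 0 < b := inv_pos.2 (abs_pos.2 hz)
  set t : ℝ := ε / (2 * (b * b * b)) with ht
  have ht0 : 0 < t := by positivity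
  -- The square is a limit of products with `w ≠ z`. Moving `w` away from the real axis keeps the
  -- bound `b`, and `t` makes the error `b * t * b ^ 2 = ε / 2`.
  obtain ⟨w, hw, hzw, hwb, hdist⟩ : ∃ w : ℂ, ∃ _ : w.im ≠ 0, z ≠ w ∧ |w.im|⁻¹ ≤ b ∧
      ‖z - w‖ = t := by
    rcases lt_or_gt_of_ne hz with h | h
    · refine ⟨z - t * Complex.I, ?_, ?_, ?_, ?_⟩
      · simp; linarith
      · intro h'; have := congrArg Complex.im h'; simp at this; linarith
      · rw [hb]
        refine inv_anti₀ (abs_pos.2 hz) ?_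
        have h1 : (z - t * Complex.I).im = z.im - t := by simp
        rw [h1, abs_of_neg h, abs_of_neg (by linarith)]; linarith
      · simp [ht0.le]
    · refine ⟨z + t * Complex.I, ?_, ?_, ?_, ?_⟩
      · simp; linarith
      · intro h'; have := congrArg Complex.im h'; simp at this; linarith
      · rw [hb]
        refine inv_anti₀ (abs_pos.2 hz) ?_
        have h1 : (z + t * Complex.I).im = z.im + t := by simp
        rw [h1, abs_of_pos h, abs_of_pos (by linarith)]; linarith
      · simp [ht0.le]
  refine ⟨_, resolventMap_mul_mem_of_ne hz hw hzw, ?_⟩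
  have hzn := norm_resolventMap_le z hz
  have hwn := (norm_resolventMap_le w hw).trans hwb
  rw [dist_eq_norm, ← mul_sub, resolventMap_sub]
  calc _ ≤ ‖resolventMap z hz‖ * (‖z - w‖ * (‖resolventMap z hz‖ * ‖resolventMap w hw‖)) :=
        (norm_mul_le _ _).trans (mul_le_mul_of_nonneg_left
          ((norm_smul_le _ _).trans
            (mul_le_mul_of_nonneg_left (norm_mul_le _ _) (norm_nonneg _))) (norm_nonneg _))
    _ ≤ b * (t * (b * b)) := by rw [hdist]; gcongr
    _ = ε / 2 := by rw [ht]; field_simp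
    _ < ε := half_lt_self hε

theorem mul_mem_resolventSpan {f g : C(OnePoint ℝ, ℂ)} (hf : f ∈ resolventSpan)
    (hg : g ∈ resolventSpan) : f * g ∈ resolventSpan := by
  have key : ∀ a ∈ Submodule.span ℂ (insert 1 {f | ∃ z hz, f = resolventMap z hz}),
      ∀ b ∈ Submodule.span ℂ (insert 1 {f | ∃ z hz, f = resolventMap z hz}),
        a * b ∈ resolventSpan := by
    intro a ha b hb
    induction ha using Submodule.span_induction with
    | zero => simp
    | add x y _ _ hx hy => rw [add_mul]; exact add_mem hx hy
    | smul c x _ hx => rw [smul_mul_assoc]; exact resolventSpan.smul_mem c hx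
    | mem x hx =>
      induction hb using Submodule.span_induction with
      | zero => simp
      | add y y' _ _ hy hy' => rw [mul_add]; exact add_mem hy hy'
      | smul c y _ hy => rw [mul_smul_comm]; exact resolventSpan.smul_mem c hy
      | mem y hy =>
        rcases hx with rfl | ⟨z, hz, rfl⟩
        · rw [one_mul]
          exact Submodule.le_topologicalClosure _ (Submodule.subset_span hy)
        · rcases hy with rfl | ⟨w, hw, rfl⟩
          · rw [mul_one]
            exact resolventMap_mem_resolventSpan z hz
          · exact resolventMap_mul_mem z w hz hw
  have := map_mem_closure₂ (continuous_mul (M := C(OnePoint ℝ, ℂ))) hf hg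
    (fun a ha b hb => key a ha b hb)
  rwa [isClosed_resolventSpan.closure_eq] at this

theorem star_mem_resolventSpan {f : C(OnePoint ℝ, ℂ)} (hf : f ∈ resolventSpan) :
    star f ∈ resolventSpan := by
  have key : ∀ a ∈ Submodule.span ℂ (insert 1 {f | ∃ z hz, f = resolventMap z hz}),
      star a ∈ resolventSpan := by
    intro a ha
    induction ha using Submodule.span_induction with
    | zero => simp
    | add x y _ _ hx hy => rw [star_add]; exact add_mem hx hy
    | smul c x _ hx => rw [star_smul]; exact resolventSpan.smul_mem _ hx
    | mem x hx =>
      rcases hx with rfl | ⟨z, hz, rfl⟩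
      · rw [star_one]; exact one_mem_resolventSpan
      · rw [star_resolventMap]; exact resolventMap_mem_resolventSpan _ _
  have := map_mem_closure (continuous_star (R := C(OnePoint ℝ, ℂ))) hf key
  rwa [isClosed_resolventSpan.closure_eq] at this

/-- Stone–Weierstrass: the span is a closed star subalgebra, and `1 / (x - i)` alone separates
points, being injective on the line and zero only at infinity. -/
theorem resolventSpan_eq_top : resolventSpan = ⊤ := by
  let A : StarSubalgebra ℂ C(OnePoint ℝ, ℂ) :=
    { carrier := resolventSpan
      mul_mem' := mul_mem_resolventSpan
      add_mem' := resolventSpan.add_mem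
      algebraMap_mem' := fun c => by
        rw [Algebra.algebraMap_eq_smul_one]
        exact resolventSpan.smul_mem c one_mem_resolventSpan
      star_mem' := star_mem_resolventSpan }
  have hI : Complex.I.im ≠ 0 := by simp
  have hsep : A.SeparatesPoints := by
    intro x y hxy
    refine ⟨resolventMap Complex.I hI,
      ⟨resolventMap Complex.I hI, resolventMap_mem_resolventSpan _ hI, rfl⟩, ?_⟩
    induction x using OnePoint.rec with
    | infty =>
      induction y using OnePoint.rec with
      | infty => exact absurd rfl hxy
      | coe y =>
        rw [resolventMap_infty, resolventMap_coe]
        exact (inv_ne_zero (ofReal_sub_ne_zero y hI)).symm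
    | coe x =>
      induction y using OnePoint.rec with
      | infty =>
        rw [resolventMap_infty, resolventMap_coe]
        exact inv_ne_zero (ofReal_sub_ne_zero x hI)
      | coe y =>
        rw [resolventMap_coe, resolventMap_coe]
        intro h
        apply hxy
        simpa using h
  have htop := ContinuousMap.starSubalgebra_topologicalClosure_eq_top_of_separatesPoints A hsep
  refine Submodule.eq_top_iff'.2 fun f => ?_
  have hf : f ∈ A.topologicalClosure := htop ▸ trivial
  exact isClosed_resolventSpan.closure_subset_iff.2 subset_rfl hf

/-- Contractive linear functionals converge pointwise as soon as they converge on the constants and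
on the resolvent functions. -/
theorem tendsto_of_tendsto_resolventMap {ι : Type*} {l : Filter ι}
    (L : ι → C(OnePoint ℝ, ℂ) →ₗ[ℂ] ℂ) (L₀ : C(OnePoint ℝ, ℂ) →ₗ[ℂ] ℂ)
    (hL : ∀ i f, ‖L i f‖ ≤ ‖f‖) (hL₀ : ∀ f, ‖L₀ f‖ ≤ ‖f‖)
    (hone : Tendsto (fun i => L i 1) l (𝓝 (L₀ 1)))
    (hres : ∀ z hz, Tendsto (fun i => L i (resolventMap z hz)) l (𝓝 (L₀ (resolventMap z hz))))
    (f : C(OnePoint ℝ, ℂ)) : Tendsto (fun i => L i f) l (𝓝 (L₀ f)) := by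
  have hf : f ∈ resolventSpan := resolventSpan_eq_top ▸ trivial
  have hspan : ∀ g ∈ Submodule.span ℂ (insert 1 {f | ∃ z hz, f = resolventMap z hz}),
      Tendsto (fun i => L i g) l (𝓝 (L₀ g)) := by
    intro g hg
    induction hg using Submodule.span_induction with
    | zero => simp only [map_zero, tendsto_const_nhds]
    | add x y _ _ hx hy => simp only [map_add]; exact hx.add hy
    | smul c x _ hx => simp only [map_smul, smul_eq_mul]; exact hx.const_mul c
    | mem x hx =>
      rcases hx with rfl | ⟨z, hz, rfl⟩
      · exact hone
      · exact hres z hz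
  refine Metric.tendsto_nhds.2 fun ε hε => ?_
  obtain ⟨g, hg, hfg⟩ := Metric.mem_closure_iff.1 hf (ε / 3) (by positivity)
  have hlim := hspan g hg
  filter_upwards [Metric.tendsto_nhds.1 hlim (ε / 3) (by positivity)] with i hi
  have h1 : dist (L i f) (L i g) < ε / 3 := by
    rw [dist_eq_norm, ← map_sub]
    exact (hL i _).trans_lt (by rwa [← dist_eq_norm])
  have h2 : dist (L₀ g) (L₀ f) < ε / 3 := by
    rw [dist_comm, dist_eq_norm, ← map_sub]
    exact (hL₀ _).trans_lt (by rwa [← dist_eq_norm])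
  have h3 := dist_triangle4 (L i f) (L i g) (L₀ g) (L₀ f)
  linarith

/-! ### The spectral symbol of Toeplitz grid graphs -/

/-- Almost all of `s` is a measurable set of points of relative continuity, and on that set `f` is
continuous. -/
theorem aemeasurable_of_ae_continuousWithinAt {X Y : Type*} [TopologicalSpace X]
    [MeasurableSpace X] [OpensMeasurableSpace X] [TopologicalSpace Y] [MeasurableSpace Y]
    [BorelSpace Y] {μ : Measure X} {s : Set X} (hs : NullMeasurableSet s μ) {f : X → Y}
    (hf : ∀ᵐ x ∂μ.restrict s, ContinuousWithinAt f s x) : AEMeasurable f (μ.restrict s) := by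
  set C : Set X := {x | x ∈ s ∧ ContinuousWithinAt f s x}
  have hCs : C =ᵐ[μ] s := by
    filter_upwards [(ae_restrict_iff'₀ hs).1 hf] with x hx
    exact propext ⟨fun h => h.1, fun h => ⟨h, hx h⟩⟩
  obtain ⟨t, htC, ht, htC'⟩ := (hs.congr hCs.symm).exists_measurable_subset_ae_eq
  rw [← Measure.restrict_congr_set (htC'.trans hCs)]
  refine ContinuousOn.aemeasurable (fun x hx => ?_) ht
  exact (htC hx).2.mono fun y hy => (htC hy).1

/-- The mean over the eigenvalues of a Hermitian matrix as a functional on continuous functions. -/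
noncomputable def hermitianMean {V : Type*} [Fintype V] [DecidableEq V] {A : Matrix V V ℂ}
    (hA : A.IsHermitian) : C(OnePoint ℝ, ℂ) →ₗ[ℂ] ℂ where
  toFun f := (Fintype.card V : ℂ)⁻¹ * ∑ i, f (hA.eigenvalues i : OnePoint ℝ)
  map_add' f g := by simp [Finset.sum_add_distrib, mul_add]
  map_smul' c f := by
    simp only [ContinuousMap.smul_apply, smul_eq_mul, ← Finset.mul_sum, RingHom.id_apply]
    ring

theorem norm_hermitianMean_le {V : Type*} [Fintype V] [DecidableEq V] {A : Matrix V V ℂ}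
    (hA : A.IsHermitian) (f : C(OnePoint ℝ, ℂ)) : ‖hermitianMean hA f‖ ≤ ‖f‖ := by
  have h1 : ‖∑ i, f (hA.eigenvalues i : OnePoint ℝ)‖ ≤ Fintype.card V * ‖f‖ := by
    refine (norm_sum_le_of_le _ fun i _ => f.norm_coe_le_norm _).trans ?_
    simp
  change ‖(Fintype.card V : ℂ)⁻¹ * _‖ ≤ _
  rw [norm_mul, norm_inv, Complex.norm_natCast]
  rcases Nat.eq_zero_or_pos (Fintype.card V) with h | h
  · simp [h]
  · rw [inv_mul_le_iff₀ (by exact_mod_cast h)]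
    exact h1

theorem integrable_comp_onePoint {E : Type*} [MeasurableSpace E] {μ : Measure E}
    [IsFiniteMeasure μ] {g : E → ℝ} (hg : AEMeasurable g μ) (f : C(OnePoint ℝ, ℂ)) :
    Integrable (fun y => f (g y : OnePoint ℝ)) μ := by
  refine Integrable.of_bound ?_ ‖f‖ (Eventually.of_forall fun y => f.norm_coe_le_norm _)
  exact (f.continuous.comp OnePoint.continuous_coe).comp_aestronglyMeasurable
    hg.aestronglyMeasurable

/-- The mean of a continuous function over the values of a measurable function. -/
noncomputable def symbolMean {E : Type*} [MeasurableSpace E] (μ : Measure E)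
    [IsFiniteMeasure μ] {g : E → ℝ} (hg : AEMeasurable g μ) : C(OnePoint ℝ, ℂ) →ₗ[ℂ] ℂ where
  toFun f := (μ.real Set.univ : ℂ)⁻¹ * ∫ y, f (g y : OnePoint ℝ) ∂μ
  map_add' f f' := by
    simp only [ContinuousMap.add_apply]
    rw [integral_add (integrable_comp_onePoint hg f) (integrable_comp_onePoint hg f'), mul_add]
  map_smul' c f := by
    simp only [ContinuousMap.smul_apply, smul_eq_mul, RingHom.id_apply]
    rw [integral_const_mul]
    ring

theorem norm_symbolMean_le {E : Type*} [MeasurableSpace E] (μ : Measure E)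
    [IsFiniteMeasure μ] {g : E → ℝ} (hg : AEMeasurable g μ) (f : C(OnePoint ℝ, ℂ)) :
    ‖symbolMean μ hg f‖ ≤ ‖f‖ := by
  have h1 : ‖∫ y, f (g y : OnePoint ℝ) ∂μ‖ ≤ ‖f‖ * μ.real Set.univ :=
    norm_integral_le_of_norm_le_const (Eventually.of_forall fun y => f.norm_coe_le_norm _)
  change ‖(μ.real Set.univ : ℂ)⁻¹ * _‖ ≤ _
  rw [norm_mul, norm_inv, Complex.norm_real, Real.norm_of_nonneg measureReal_nonneg]
  rcases (measureReal_nonneg (μ := μ) (s := Set.univ)).eq_or_lt with h | h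
  · simp [← h]
  · rw [inv_mul_le_iff₀ h, mul_comm]
    exact h1

namespace ToeplitzData

variable {d : ℕ}

theorem ae_continuousAt_of_mem_interior {Ω : Set (Fin d → ℝ)} (hΩ : IsRegularDomain Ω)
    {p : (Fin d → ℝ) → ℝ} (hp : ∀ᵐ x ∂volume.restrict Ω, ContinuousWithinAt p Ω x) :
    ∀ᵐ x, x ∈ interior Ω → ContinuousAt p x := by
  filter_upwards [(ae_restrict_iff'₀ hΩ.measurable).1 hp] with x hx hxi
  exact (hx (interior_subset hxi)).continuousAt (mem_interior_iff_mem_nhds.1 hxi)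

theorem volume_ne_top {Ω : Set (Fin d → ℝ)} (hΩ : IsRegularDomain Ω) : volume Ω ≠ ⊤ :=
  ((measure_mono hΩ.subset_cube).trans_lt isCompact_Icc.measure_lt_top).ne

theorem tendsto_card_div {Ω : Set (Fin d → ℝ)} (hΩ : IsRegularDomain Ω) :
    Tendsto (fun n => (cellCount n : ℂ)⁻¹ * (Fintype.card (domainNodes Ω n) : ℂ)) atTop
      (𝓝 (volume.real Ω : ℂ)) := by
  have h := tendsto_sum_domainNodes hΩ (fun _ _ => 1) 1 (by simp) (fun _ => 1)
    (Eventually.of_forall fun x _ => tendsto_const_nhds)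
  simpa [Finset.sum_const] using h

theorem volume_real_pos {Ω : Set (Fin d → ℝ)} (hΩ : IsRegularDomain Ω) (hpos : 0 < volume Ω) :
    0 < volume.real Ω := ENNReal.toReal_pos hpos.ne' (volume_ne_top hΩ)

theorem tendsto_card_domainNodes (hd : 1 ≤ d) {Ω : Set (Fin d → ℝ)} (hΩ : IsRegularDomain Ω)
    (hpos : 0 < volume Ω) :
    Tendsto (fun n => Fintype.card (domainNodes Ω n)) atTop atTop := by
  have h1 : Tendsto (fun n => (cellCount n)⁻¹ * (Fintype.card (domainNodes Ω n) : ℝ)) atTop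
      (𝓝 (volume.real Ω)) := by
    have h := (Complex.continuous_re.tendsto _).comp (tendsto_card_div hΩ)
    refine (h.congr fun n => ?_)
    rw [Function.comp_apply, ← Complex.ofReal_inv, ← Complex.ofReal_natCast, ← Complex.ofReal_mul,
      Complex.ofReal_re]
  have h2 := (tendsto_cellCount hd).atTop_mul_pos (volume_real_pos hΩ hpos) h1
  refine tendsto_natCast_atTop_iff.1 (h2.congr fun n => ?_)
  rw [mul_inv_cancel_left₀ (cellCount_pos n).ne']

/-- The mean is a quotient of two Riemann sums, the trace of the resolvent over the number of nodes,
in which `cellCount` cancels. -/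
theorem tendsto_hermitianMean_resolventMap (T : ToeplitzData d) {Ω : Set (Fin d → ℝ)}
    (hΩ : IsRegularDomain Ω) (hpos : 0 < volume Ω) {p : (Fin d → ℝ) → ℝ}
    (hp : ∀ᵐ x ∂volume.restrict Ω, ContinuousWithinAt p Ω x) (z : ℂ) (hz : z.im ≠ 0) :
    Tendsto (fun n => hermitianMean (T.gridMatrix_isHermitian p Ω n) (resolventMap z hz)) atTop
      (𝓝 ((volume.real Ω : ℂ)⁻¹ * ∫ x in Ω, T.localResolvent z (p x))) := by
  choose G hG hGtr using fun n => exists_resolvent (T.gridMatrix_isHermitian p Ω n) hz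
  have h1 : Tendsto (fun n => (cellCount n : ℂ)⁻¹ * ∑ j ∈ domainNodes Ω n, nodeDiag (G n) j) atTop
      (𝓝 (∫ x in Ω, T.localResolvent z (p x))) := by
    refine tendsto_sum_domainNodes hΩ (fun n => nodeDiag (G n)) |z.im|⁻¹ (fun n j hj => ?_) _ ?_
    · rw [nodeDiag_of_mem _ hj, ← one_div, le_div_iff₀' (abs_pos.2 hz)]
      exact abs_im_mul_norm_resolvent_le (T.gridMatrix_isHermitian p Ω n) z (hG n) _
    · filter_upwards [ae_continuousAt_of_mem_interior hΩ hp] with x hx hxi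
      exact T.tendsto_nodeDiag_resolvent hΩ hz G hG hxi (hx hxi)
  have hne : (volume.real Ω : ℂ) ≠ 0 := by exact_mod_cast (volume_real_pos hΩ hpos).ne'
  refine (((tendsto_card_div hΩ).inv₀ hne).mul h1).congr fun n => ?_
  have hn : (cellCount n : ℂ) ≠ 0 := by exact_mod_cast (cellCount_pos n).ne'
  rw [sum_nodeDiag, hGtr, mul_inv, inv_inv, mul_comm (cellCount n : ℂ), mul_assoc,
    mul_inv_cancel_left₀ hn]
  rfl

theorem continuous_symbol (T : ToeplitzData d) : Continuous T.symbol := by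
  unfold symbol
  fun_prop

/-- The cube of angles. -/
def angles (d : ℕ) : Set (Fin d → ℝ) :=
  Set.Icc (fun _ : Fin d => -Real.pi) (fun _ : Fin d => Real.pi)

theorem volume_angles : volume (angles d) = ENNReal.ofReal ((2 * Real.pi) ^ d) := by
  rw [angles, Real.volume_Icc_pi, ENNReal.ofReal_pow (by positivity)]
  simp [← two_mul]

theorem aemeasurable_symbol (T : ToeplitzData d) {Ω : Set (Fin d → ℝ)}
    (hΩ : IsRegularDomain Ω) {p : (Fin d → ℝ) → ℝ}
    (hp : ∀ᵐ x ∂volume.restrict Ω, ContinuousWithinAt p Ω x) :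
    AEMeasurable (fun y : (Fin d → ℝ) × (Fin d → ℝ) => p y.1 * T.symbol y.2)
      (volume.restrict (Ω ×ˢ angles d)) := by
  rw [Measure.volume_eq_prod, ← Measure.prod_restrict]
  exact (aemeasurable_of_ae_continuousWithinAt hΩ.measurable hp).comp_fst.mul
    (T.continuous_symbol.measurable.comp measurable_snd).aemeasurable

theorem volume_prod_angles (Ω : Set (Fin d → ℝ)) :
    volume (Ω ×ˢ angles d) = volume Ω * ENNReal.ofReal ((2 * Real.pi) ^ d) := by
  rw [Measure.volume_eq_prod, Measure.prod_prod, volume_angles]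

theorem integral_resolventMap_symbol (T : ToeplitzData d) {Ω : Set (Fin d → ℝ)}
    (hΩ : IsRegularDomain Ω) {p : (Fin d → ℝ) → ℝ}
    (hp : ∀ᵐ x ∂volume.restrict Ω, ContinuousWithinAt p Ω x) (z : ℂ) (hz : z.im ≠ 0) :
    ∫ y in Ω ×ˢ angles d, resolventMap z hz ((p y.1 * T.symbol y.2 : ℝ) : OnePoint ℝ) =
      ((2 * Real.pi) ^ d : ℝ) * ∫ x in Ω, T.localResolvent z (p x) := by
  have hfin : IsFiniteMeasure
      ((volume : Measure ((Fin d → ℝ) × (Fin d → ℝ))).restrict (Ω ×ˢ angles d)) :=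
    isFiniteMeasure_restrict.2 (by
      rw [volume_prod_angles]
      exact ENNReal.mul_ne_top (volume_ne_top hΩ) ENNReal.ofReal_ne_top)
  have hint := integrable_comp_onePoint (T.aemeasurable_symbol hΩ hp) (resolventMap z hz)
  rw [Measure.volume_eq_prod] at hint ⊢
  rw [setIntegral_prod _ hint, ← integral_const_mul]
  refine integral_congr_ae (Eventually.of_forall fun x => ?_)
  simp only [resolventMap_coe, localResolvent, angles, Complex.real_smul]
  rw [← mul_assoc, ← Complex.ofReal_mul, mul_inv_cancel₀ (by positivity), Complex.ofReal_one,
    one_mul]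

/-- A compactly supported function, restricted to the real line and extended by zero to its
one-point compactification. -/
noncomputable def onePointExtension (F : ℂ → ℂ) (hF : Continuous F) (hF' : HasCompactSupport F) :
    C(OnePoint ℝ, ℂ) :=
  OnePoint.continuousMapMk ⟨fun x : ℝ => F x, hF.comp Complex.continuous_ofReal⟩ 0 (by
    rw [coclosedCompact_eq_cocompact]
    exact (hF'.comp_isClosedEmbedding
      Complex.isometry_ofReal.isClosedEmbedding).is_zero_at_infty)

theorem hasSpectralSymbol_gridMatrix {d : ℕ} (hd : 1 ≤ d) {Ω : Set (Fin d → ℝ)}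
    (hΩ : IsRegularDomain Ω) (hpos : 0 < volume Ω) {p : (Fin d → ℝ) → ℝ}
    (hp : ∀ᵐ x ∂volume.restrict Ω, ContinuousWithinAt p Ω x) (T : ToeplitzData d) :
    HasSpectralSymbol (T.gridMatrix p Ω) (Ω ×ˢ angles d)
      (fun y : (Fin d → ℝ) × (Fin d → ℝ) => p y.1 * T.symbol y.2) := by
  have hpi : 0 < (2 * Real.pi) ^ d := by positivity
  have hlt : volume (Ω ×ˢ angles d) < ⊤ := by
    rw [volume_prod_angles]
    exact ENNReal.mul_lt_top (volume_ne_top hΩ).lt_top ENNReal.ofReal_lt_top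
  have hvol : 0 < volume (Ω ×ˢ angles d) := by
    rw [volume_prod_angles]
    exact ENNReal.mul_pos hpos.ne' (ENNReal.ofReal_pos.2 hpi).ne'
  have hg := T.aemeasurable_symbol hΩ hp
  have hcard := tendsto_card_domainNodes hd hΩ hpos
  refine ⟨hcard, ?_, hvol, hlt, hg, fun F hF hF' => ?_⟩
  · exact hΩ.measurable.prod measurableSet_Icc.nullMeasurableSet
  have : IsFiniteMeasure
      ((volume : Measure ((Fin d → ℝ) × (Fin d → ℝ))).restrict (Ω ×ˢ angles d)) :=
    isFiniteMeasure_restrict.2 hlt.ne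
  have hreal : ((volume : Measure ((Fin d → ℝ) × (Fin d → ℝ))).restrict (Ω ×ˢ angles d)).real
      Set.univ = volume.real Ω * (2 * Real.pi) ^ d := by
    rw [measureReal_restrict_apply_univ, measureReal_def, volume_prod_angles, ENNReal.toReal_mul,
      ENNReal.toReal_ofReal hpi.le, measureReal_def]
  have hΩne : (volume.real Ω : ℂ) ≠ 0 := by exact_mod_cast (volume_real_pos hΩ hpos).ne'
  have hpine : (((2 * Real.pi) ^ d : ℝ) : ℂ) ≠ 0 := by exact_mod_cast hpi.ne'
  have key := tendsto_of_tendsto_resolventMap (l := atTop)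
    (fun n => hermitianMean (T.gridMatrix_isHermitian p Ω n)) (symbolMean _ hg)
    (fun n => norm_hermitianMean_le _) (norm_symbolMean_le _ hg) ?_ ?_
    (onePointExtension F hF hF')
  -- Eigenvalues and symbol values are real, so only the restriction of `F` to the line is seen.
  · have h2 : ∀ n, hermitianMean (T.gridMatrix_isHermitian p Ω n) (onePointExtension F hF hF') =
        eigenvalueMean F (T.gridMatrix p Ω n) := fun n =>
      (eigenvalueMean_eq_sum (T.gridMatrix_isHermitian p Ω n) F).symm
    simp only [h2] at key
    convert key using 2
    change _ = (((volume.restrict (Ω ×ˢ angles d)).real Set.univ : ℝ) : ℂ)⁻¹ * _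
    rw [measureReal_restrict_apply_univ]
    rfl
  -- The mean of `1` is `1` only once there are nodes; for an empty node set it is `0`.
  · refine tendsto_const_nhds.congr' (f₁ := fun _ => (1 : ℂ)) ?_ |>.trans (le_of_eq ?_)
    · filter_upwards [hcard.eventually_gt_atTop 0] with n hn
      have hn' : (Fintype.card (domainNodes Ω n) : ℂ) ≠ 0 := by exact_mod_cast hn.ne'
      change _ = (Fintype.card (domainNodes Ω n) : ℂ)⁻¹ * ∑ _, (1 : ℂ)
      rw [Finset.sum_const, Finset.card_univ, nsmul_one, inv_mul_cancel₀ hn']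
    · congr 1
      change _ = (((volume.restrict (Ω ×ˢ angles d)).real Set.univ : ℝ) : ℂ)⁻¹ * ∫ _, (1 : ℂ) ∂_
      rw [integral_const, Complex.real_smul, mul_one, inv_mul_cancel₀]
      rw [hreal, Complex.ofReal_mul]
      exact mul_ne_zero hΩne hpine
  · intro z hz
    have h1 := T.tendsto_hermitianMean_resolventMap hΩ hpos hp z hz
    convert h1 using 2
    change (((volume.restrict (Ω ×ˢ angles d)).real Set.univ : ℝ) : ℂ)⁻¹ *
      ∫ y in Ω ×ˢ angles d, resolventMap z hz ((p y.1 * T.symbol y.2 : ℝ) : OnePoint ℝ) = _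
    rw [hreal, T.integral_resolventMap_symbol hΩ hp z hz, Complex.ofReal_mul, mul_inv, mul_assoc,
      inv_mul_cancel_left₀ hpine]

end ToeplitzData

end ToeplitzGrid

theorem theorem4p0 {d : ℕ} (hd : 1 ≤ d) (Ω : Set (Fin d → ℝ))
    (hΩ : ToeplitzGrid.IsRegularDomain Ω) (hΩ_pos : 0 < volume Ω)
    (p : (Fin d → ℝ) → ℝ)
    (hp : ∀ᵐ x ∂(volume.restrict Ω), ContinuousWithinAt p Ω x)
    (T : ToeplitzGrid.ToeplitzData d) :
    ToeplitzGrid.HasSpectralSymbol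
      (fun n : Fin d → ℕ =>
        (T.domainGridGraph p Ω n).adjacencyMatrix.map (fun a : ℝ => (a : ℂ)))
      (Ω ×ˢ Set.Icc (fun _ : Fin d => -Real.pi) (fun _ : Fin d => Real.pi))
      (fun y : (Fin d → ℝ) × (Fin d → ℝ) => p y.1 * T.symbol y.2) :=
  ToeplitzGrid.ToeplitzData.hasSpectralSymbol_gridMatrix hd hΩ hΩ_pos hp T
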